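/- Let $\Sigma$ be a finite alphabet and $V$ a finite set of variables. A Boolean VSet-automaton $A$ over $(\Sigma,V)$ is a finite automaton with a finite set of states, initial states and accepting states, whose transitions are labelled by letters of $\Sigma$, by $\varepsilon$, or by variable operations $v{\vdash}$ (open $v$) and ${\dashv}v$ (close $v$) with $v\in V$, and which has no $\varepsilon$-cycles; it is regarded as a weighted automaton over the Boolean semiring $\mathbb{B}$. A run of $A$ on a document $d=d_1\cdots d_n\in\Sigma^*$ is a sequence of transitions from an initial to an accepting state whose sequence of letters is $d$. A run is valid if it opens every $v\in V$ exactly once and closes it exactly once, after opening it; a valid run $\rho$ defines the $V$-tuple $\mathbf{t}_\rho$ that maps $v$ to the span $[i,j\rangle$, where $i$ and $j$ are the positions in $d$ (from $1$ to $n+1$) at which $v$ is opened and closed. The annotator $[\![A]\!]_{\mathbb{B}}$ maps a document $d$ to the $\mathbb{B}$-relation over $V$ in which the annotation of $\mathbf{t}$ is the sum (disjunction) of the weights of the valid runs $\rho$ of $A$ on $d$ with $\mathbf{t}_\rho=\mathbf{t}$. $A$ is functional if all its runs are valid, and unambiguous if for every $d$ and every $\mathbf{t}$ in $[\![A]\!]_{\mathbb{B}}(d)$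 there is exactly one valid run $\rho$ of $A$ on $d$ with $\mathbf{t}_\rho=\mathbf{t}$. The natural join of annotators $S_1,S_2$ with variables $V_1,V_2$ is the annotator with variables $V_1\cup V_2$ given by $(S_1\bowtie S_2)(d)(\mathbf{t})=S_1(d)(\mathbf{t}{\upharpoonright}V_1)\wedge S_2(d)(\mathbf{t}{\upharpoonright}V_2)$. **Corollary.** There is a polynomial-time algorithm which, given two unambiguous functional Boolean VSet-automata $A_1$ and $A_2$ over the same finite alphabet, with sets of variables $V_1$ and $V_2$, constructs an unambiguous functional Boolean VSet-automaton $A$ with set of variables $V_1\cup V_2$ such that $$[\![A]\!]_{\mathbb{B}} = [\![A_1]\!]_{\mathbb{B}} \bowtie [\![A_2]\!]_{\mathbb{B}}.$$ Automata are given as explicit lists of their letters, variables, states, initial states, accepting states and transitions, and polynomial time is measured in the length of this encoding. -/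

import Mathlib

namespace VSet

/-! ### The Boolean semiring -/

/-- The Boolean semiring `({false, true}, or, and, false, true)`. (Mathlib's ring structure on
`Bool` has exclusive or as addition, hence the separate type.) -/
inductive BoolSR : Type
  | ff
  | tt

namespace BoolSR

/-- Disjunction. -/
def or : BoolSR → BoolSR → BoolSR
  | ff, b => b
  | tt, _ => tt

/-- Conjunction. -/
def and : BoolSR → BoolSR → BoolSR
  | ff, _ => ff
  | tt, b => b

instance instZero : Zero BoolSR := ⟨ff⟩

instance instOne : One BoolSR := ⟨tt⟩

instance instAdd : Add BoolSR := ⟨or⟩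

instance instMul : Mul BoolSR := ⟨and⟩

instance instCommSemiring : CommSemiring BoolSR where
  add_assoc := by rintro (_ | _) (_ | _) (_ | _) <;> rfl
  zero_add := by rintro (_ | _) <;> rfl
  add_zero := by rintro (_ | _) <;> rfl
  add_comm := by rintro (_ | _) (_ | _) <;> rfl
  mul_assoc := by rintro (_ | _) (_ | _) (_ | _) <;> rfl
  one_mul := by rintro (_ | _) <;> rfl
  mul_one := by rintro (_ | _) <;> rfl
  mul_comm := by rintro (_ | _) (_ | _) <;> rfl
  zero_mul := by rintro (_ | _) <;> rfl
  mul_zero := by rintro (_ | _) <;> rfl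
  left_distrib := by rintro (_ | _) (_ | _) (_ | _) <;> rfl
  right_distrib := by rintro (_ | _) (_ | _) (_ | _) <;> rfl
  nsmul := nsmulRec

end BoolSR

/-! ### Annotated relations and annotators -/

/-- Data values: pairs `(i, j)`. The spans `[i, j⟩` of a document of length `n` are the pairs with
`1 ≤ i ≤ j ≤ n + 1`. -/
abbrev Value : Type := ℕ × ℕ

/-- `V`-tuples. -/
abbrev Tuple {Var : Type} (V : Finset Var) : Type := V → Value

/-- The restriction of a tuple to a subset of its variables. -/
def Tuple.restrict {Var : Type} {V X : Finset Var} (h : X ⊆ V) (t : Tuple V) : Tuple X :=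
  fun v => t ⟨v.1, h v.2⟩

/-- A `K`-annotator with variables `V` over the alphabet `Alph` maps each document (a word over
`Alph`) to an assignment of an element of `K` to each `V`-tuple. -/
abbrev Annotator (K Alph : Type) {Var : Type} (V : Finset Var) : Type :=
  List Alph → Tuple V → K

/-- The natural join of two annotators. -/
def Annotator.join {K Alph Var : Type} [CommSemiring K] [DecidableEq Var] {V₁ V₂ : Finset Var}
    (S₁ : Annotator K Alph V₁) (S₂ : Annotator K Alph V₂) : Annotator K Alph (V₁ ∪ V₂) :=
  fun d t => S₁ d (t.restrict Finset.subset_union_left) * S₂ d (t.restrict Finset.subset_union_right)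

/-! ### Weighted variable-set automata -/

/-- Transition labels: letters, `ε`, and the operations opening and closing a variable of `V`. -/
inductive Label (Alph : Type) {Var : Type} (V : Finset Var) : Type
  | letter (a : Alph)
  | eps
  | opn (v : V)
  | cls (v : V)

/-- The letter read by a label, if any. -/
def Label.letter? {Alph Var : Type} {V : Finset Var} : Label Alph V → Option Alph
  | .letter a => some a
  | _ => none

/-- A `K`-weighted variable-set automaton over the alphabet `Alph` with set of variables `V`,
without `ε`-cycles. -/
structure Automaton (K Alph : Type) [CommSemiring K] {Var : Type} (V : Finset Var) where
  /-- States. -/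
  Q : Type
  finite_Q : Finite Q
  /-- Initial weights. -/
  init : Q → K
  /-- Final weights. -/
  fin : Q → K
  /-- Transition weights. -/
  δ : Q → Label Alph V → Q → K
  no_eps_cycle : ∀ q, ¬ Relation.TransGen (fun p p' => δ p Label.eps p' ≠ 0) q q

namespace Automaton

variable {K Alph Var : Type} [CommSemiring K] {V : Finset Var}

/-- `A.IsPath q s`: the list `s = [(o₁, q₁), …, (oₘ, qₘ)]` describes transitions
`q → q₁ → … → qₘ` of nonzero weight labelled `o₁, …, oₘ`, ending in an accepting state. -/
def IsPath (A : Automaton K Alph V) : A.Q → List (Label Alph V × A.Q) → Prop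
  | q, [] => A.fin q ≠ 0
  | q, (o, r) :: s => A.δ q o r ≠ 0 ∧ A.IsPath r s

/-- The product of the transition weights along a path and the final weight of its last state. -/
def pathWeight (A : Automaton K Alph V) : A.Q → List (Label Alph V × A.Q) → K
  | q, [] => A.fin q
  | q, (o, r) :: s => A.δ q o r * A.pathWeight r s

/-- A run of `A` on the document `d`, given by its first state and the list of the labels and
target states of its steps. The positions in `d` are determined by the labels: a step advances the
position by one exactly if it reads a letter. -/
structure Run (A : Automaton K Alph V) (d : List Alph) where
  /-- The first state. -/
  start : A.Q
  /-- Labels and target states. -/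
  steps : List (Label Alph V × A.Q)
  init_ne : A.init start ≠ 0
  isPath : A.IsPath start steps
  reads : (steps.map Prod.fst).filterMap Label.letter? = d

namespace Run

variable {A : Automaton K Alph V} {d : List Alph}

/-- The sequence of labels of a run. -/
def labels (ρ : A.Run d) : List (Label Alph V) := ρ.steps.map Prod.fst

/-- The weight of a run. -/
def weight (ρ : A.Run d) : K := A.init ρ.start * A.pathWeight ρ.start ρ.steps

/-- A run is valid if every variable is opened exactly once and closed exactly once, and is
opened before it is closed. -/
def Valid (ρ : A.Run d) : Prop :=
  ∀ v : V, ∃ i j : ℕ, i < j ∧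
    (∀ k, ρ.labels[k]? = some (.opn v) ↔ k = i) ∧ (∀ k, ρ.labels[k]? = some (.cls v) ↔ k = j)

/-- The position in the document (counted from 1) before the step with index `k`. -/
def pos (ρ : A.Run d) (k : ℕ) : ℕ :=
  ((ρ.labels.take k).filterMap Label.letter?).length + 1

open Classical in
/-- The tuple of a valid run: each variable is mapped to the span between the position at which it
is opened and the position at which it is closed. -/
noncomputable def tuple (ρ : A.Run d) : Tuple V :=
  fun v => (ρ.pos (ρ.labels.idxOf (.opn v)), ρ.pos (ρ.labels.idxOf (.cls v)))

end Run

/-- The set of valid and nonzero runs of `A` on `d`. -/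
def validRuns (A : Automaton K Alph V) (d : List Alph) : Set (A.Run d) :=
  {ρ | ρ.Valid ∧ ρ.weight ≠ 0}

/-- The annotator defined by `A`: the annotation of a tuple `t` is the sum of the weights of the
valid and nonzero runs with tuple `t` (there are finitely many, as there are no `ε`-cycles). -/
noncomputable def annotator (A : Automaton K Alph V) : Annotator K Alph V :=
  fun d t => ∑ᶠ ρ ∈ {ρ : A.Run d | ρ ∈ A.validRuns d ∧ ρ.tuple = t}, ρ.weight

/-- All runs are valid. -/
def Functional (A : Automaton K Alph V) : Prop :=
  ∀ (d : List Alph) (ρ : A.Run d), ρ.Valid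

/-- Every extracted tuple is the tuple of exactly one valid and nonzero run. -/
def Unambiguous (A : Automaton K Alph V) : Prop :=
  ∀ (d : List Alph) (t : Tuple V), A.annotator d t ≠ 0 →
    ∃! ρ : A.Run d, ρ ∈ A.validRuns d ∧ ρ.tuple = t

end Automaton

/-! ### Polynomial time

The machine model is a Turing-complete language of programs on binary trees with `while` loops.
Each basic operation is charged the full size of the tree it is applied to, so that
the cost of a computation also bounds, up to a constant factor, the sizes of all trees that it
produces; polynomial cost in this model is the same as polynomial time on Turing machines. -/

/-- Binary trees. -/
inductive Data : Type
  | nil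
  | cons (a b : Data)
  deriving DecidableEq

namespace Data

/-- The number of nodes. -/
def size : Data → ℕ
  | nil => 1
  | cons a b => a.size + b.size + 1

/-- Left component. -/
def hd : Data → Data
  | nil => nil
  | cons a _ => a

/-- Right component. -/
def tl : Data → Data
  | nil => nil
  | cons _ b => b

/-- Lists as trees. -/
def ofList (l : List Data) : Data := l.foldr cons nil

/-- Natural numbers as trees, in unary. -/
def ofNat : ℕ → Data
  | 0 => nil
  | n + 1 => cons nil (ofNat n)

end Data

/-- Programs. -/
inductive Prog : Type
  | id
  | nil
  | hd
  | tl
  /-- Tests the two components of the argument for equality. -/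
  | eq
  | cons (f g : Prog)
  /-- First `f`, then `g`. -/
  | seq (f g : Prog)
  /-- If `c` returns a value other than `nil` then `f`, else `g`. -/
  | ite (c f g : Prog)
  /-- While `c` returns a value other than `nil`, apply `f`. -/
  | while (c f : Prog)

open Data in
/-- `p.Runs x y t`: on input `x` the program `p` halts with output `y` at cost `t`. -/
inductive Prog.Runs : Prog → Data → Data → ℕ → Prop
  | id (x) : Runs .id x x x.size
  | nil (x) : Runs .nil x .nil x.size
  | hd (x) : Runs .hd x x.hd x.size
  | tl (x) : Runs .tl x x.tl x.size
  | eq (x) : Runs .eq x (if x.hd = x.tl then .cons .nil .nil else .nil) x.size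
  | cons {f g x y z s t} : Runs f x y s → Runs g x z t → Runs (.cons f g) x (.cons y z) (s + t + 1)
  | seq {f g x y z s t} : Runs f x y s → Runs g y z t → Runs (.seq f g) x z (s + t + 1)
  | ite_true {c f g x a b y s t} : Runs c x (.cons a b) s → Runs f x y t →
      Runs (.ite c f g) x y (s + t + 1)
  | ite_false {c f g x y s t} : Runs c x .nil s → Runs g x y t → Runs (.ite c f g) x y (s + t + 1)
  | while_stop {c f x s} : Runs c x .nil s → Runs (.while c f) x x (s + x.size)
  | while_step {c f x a b y z s t u} : Runs c x (.cons a b) s → Runs f x y t →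
      Runs (.while c f) y z u → Runs (.while c f) x z (s + t + u + 1)

/-! ### Encoding of automata over the Boolean semiring -/

section Encoding

variable {Alph Var : Type} {V : Finset Var}

/-- The encoding of a label, given names for letters and variables. -/
def encLabel (nA : Alph → Data) (nV : Var → Data) : Label Alph V → Data
  | .eps => .cons (.ofNat 0) .nil
  | .letter a => .cons (.ofNat 1) (nA a)
  | .opn v => .cons (.ofNat 2) (nV v)
  | .cls v => .cons (.ofNat 3) (nV v)

/-- The encoding of a transition, given moreover names for states. -/
def encTrans {Q : Type} (nA : Alph → Data) (nV : Var → Data) (nQ : Q → Data)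
    (e : Q × Label Alph V × Q) : Data :=
  .cons (nQ e.1) (.cons (encLabel nA nV e.2.1) (nQ e.2.2))

/-- `Encodes nA nV A x`: relative to the names `nA` of letters and `nV` of variables, and to some
choice of pairwise distinct names of the states, the tree `x` is a list of six lists, which
enumerate, each in any order, the letters, the variables, the states, the initial states, the
accepting states and the transitions of `A`. -/
def Encodes (nA : Alph → Data) (nV : Var → Data) (A : Automaton BoolSR Alph V) (x : Data) : Prop :=
  ∃ nQ : A.Q → Data, Function.Injective nQ ∧
  ∃ (lA : List Alph) (lV : List V) (lQ lI lF : List A.Q) (lT : List (A.Q × Label Alph V × A.Q)),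
    (∀ a, a ∈ lA) ∧ (∀ v, v ∈ lV) ∧ (∀ q, q ∈ lQ) ∧
    (∀ q, q ∈ lI ↔ A.init q ≠ 0) ∧ (∀ q, q ∈ lF ↔ A.fin q ≠ 0) ∧
    (∀ p o q, (p, o, q) ∈ lT ↔ A.δ p o q ≠ 0) ∧
    x = .ofList [.ofList (lA.map nA), .ofList (lV.map fun v => nV v), .ofList (lQ.map nQ),
      .ofList (lI.map nQ), .ofList (lF.map nQ), .ofList (lT.map (encTrans nA nV nQ))]

end Encoding

end VSet

/-! Cut a run into blocks, the letter-free stretches before, between and after its letters. The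
tuple of a valid run depends only on which variable operations lie in which block, not on their
order inside a block. In a functional automaton, moreover, the operations of a block are determined
by its end points: exchanging one walk from p to q for another inside an accepting run must again
give a valid run, in which each operation occurs exactly once (`Functional.mem_ops_iff`).

The join is therefore a product that moves block by block. From a pair (p₁, p₂) it guesses end
points (q₁, q₂), reachable without reading a letter, between which the two automata agree on the
operations of their common variables. It then performs the union of the operations in one fixed
order, openings first, and reads the next letter in both automata. The fixed order removes the
ambiguity that interleavings of the two blocks would cause. Every run of the join projects to a pair
of runs (`JoinPath.exists_proj`), every pair of runs with compatible tuples arises in this way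
(`exists_proj_of_isPath`), and the pair determines the run of the join (`Proj.unique`). Validity and
tuples are carried across by `BlockRel`, which compares words block by block.

The construction is polynomial because the operations still to be performed always form a suffix of
the list attached to a jump, so that each jump adds at most 2|V₁ ∪ V₂| + 1 states. The jumps come
from letter-free reachability, computed by inserting one edge at a time (`mem_closure`). The program
is assembled from closure properties of `PolyTime`, above all iteration over a list with an
accumulator of polynomial size (`PolyTime.foldl`). Finally `encodes_joinAutomaton` identifies its
output with the abstract construction. -/

namespace VSet

/-! ### Trees: sizes and lists -/

namespace Data

theorem one_le_size (x : Data) : 1 ≤ x.size := by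
  cases x <;> simp [size]

theorem size_hd_le (x : Data) : x.hd.size ≤ x.size := by
  cases x <;> simp [hd, size]; omega

theorem size_tl_le (x : Data) : x.tl.size ≤ x.size := by
  cases x <;> simp [tl, size]; omega

/-- Trees as lists. -/
def toList : Data → List Data
  | nil => []
  | cons a b => a :: b.toList

@[simp] theorem ofList_nil : ofList [] = nil := rfl

@[simp] theorem ofList_cons (a : Data) (l : List Data) : ofList (a :: l) = cons a (ofList l) := rfl

@[simp] theorem hd_cons (a b : Data) : (cons a b).hd = a := rfl

@[simp] theorem tl_cons (a b : Data) : (cons a b).tl = b := rfl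

@[simp] theorem toList_ofList (l : List Data) : (ofList l).toList = l := by
  induction l with
  | nil => rfl
  | cons a l ih => simp [toList, ih]

@[simp] theorem ofList_toList (x : Data) : ofList x.toList = x := by
  induction x with
  | nil => rfl
  | cons a b _ ih => simp [toList, ih]

theorem ofList_injective : Function.Injective ofList :=
  Function.LeftInverse.injective toList_ofList

theorem ofNat_injective : Function.Injective ofNat := by
  intro m
  induction m with
  | zero => intro n h; cases n <;> simp_all [ofNat]
  | succ m ih =>
    intro n h
    cases n with
    | zero => simp [ofNat] at h
    | succ n => simp only [ofNat, cons.injEq, true_and] at h; rw [ih h]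

theorem size_le_of_mem {a : Data} {l : List Data} (h : a ∈ l) : a.size ≤ (ofList l).size := by
  induction l with
  | nil => simp at h
  | cons b l ih =>
    simp only [ofList_cons, size]
    rcases List.mem_cons.1 h with rfl | h
    · omega
    · have := ih h; omega

theorem length_le_size (l : List Data) : l.length ≤ (ofList l).size := by
  induction l with
  | nil => simp
  | cons b l ih => simp only [ofList_cons, size, List.length_cons]; omega

theorem size_ofList_append (l m : List Data) :
    (ofList (l ++ m)).size + 1 = (ofList l).size + (ofList m).size := by
  induction l with
  | nil => simp [size]; omega
  | cons b l ih => simp only [List.cons_append, ofList_cons, size]; omega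

theorem size_ofList_le_of_sublist {l m : List Data} (h : l.Sublist m) :
    (ofList l).size ≤ (ofList m).size := by
  induction h with
  | slnil => rfl
  | cons a _ ih => simp only [ofList_cons, size]; omega
  | cons_cons a _ ih => simp only [ofList_cons, size]; omega

/-- Truth values as trees. -/
def ofBool (b : Bool) : Data := if b then cons nil nil else nil

end Data

/-! ### Programs of polynomial cost -/

open Data

/-- Every basic operation is charged the size of its argument. The factor 3 is forced by the
equality test, which may return a tree of size 3 at cost 1. -/
theorem Prog.Runs.size_le {p : Prog} {x y : Data} {t : ℕ} (h : p.Runs x y t) :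
    y.size ≤ 3 * t := by
  induction h with
  | id x => omega
  | nil x => have := x.one_le_size; simp only [Data.size]; omega
  | hd x => have := x.size_hd_le; omega
  | tl x => have := x.size_tl_le; omega
  | eq x => have := x.one_le_size; split <;> simp only [Data.size] <;> omega
  | cons _ _ h₁ h₂ => simp only [Data.size]; omega
  | _ => omega

/-- Coefficients in ℕ make evaluation monotone, so that size bounds can be substituted into cost
bounds. -/
theorem eval_mono (P : Polynomial ℕ) {m n : ℕ} (h : m ≤ n) : P.eval m ≤ P.eval n := by
  induction P using Polynomial.induction_on' with
  | add p q hp hq => simp only [Polynomial.eval_add]; omega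
  | monomial k a => simp only [Polynomial.eval_monomial]; gcongr

/-- Functions computed by a program at polynomial cost. -/
def PolyTime (f : Data → Data) : Prop :=
  ∃ (p : Prog) (P : Polynomial ℕ), ∀ x, ∃ t, p.Runs x (f x) t ∧ t ≤ P.eval x.size

/-- List-valued functions computed at polynomial cost. -/
def PolyTimeList (f : Data → List Data) : Prop := PolyTime fun x => ofList (f x)

/-- Truth-valued functions computed at polynomial cost. -/
def PolyTimeBool (f : Data → Bool) : Prop := PolyTime fun x => ofBool (f x)

namespace PolyTime

variable {f g : Data → Data}

theorem of_eq (hg : PolyTime g) (h : ∀ x, f x = g x) : PolyTime f := funext h ▸ hg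

theorem size_le (hf : PolyTime f) : ∃ P : Polynomial ℕ, ∀ x, (f x).size ≤ P.eval x.size := by
  obtain ⟨p, P, h⟩ := hf
  refine ⟨3 * P, fun x => ?_⟩
  obtain ⟨t, ht, hle⟩ := h x
  have := ht.size_le
  simp only [Polynomial.eval_mul, Polynomial.eval_ofNat]
  omega

protected theorem id : PolyTime fun x => x :=
  ⟨.id, .X, fun x => ⟨_, .id x, by simp⟩⟩

protected theorem nil : PolyTime fun _ => .nil :=
  ⟨.nil, .X, fun x => ⟨_, .nil x, by simp⟩⟩

protected theorem comp (hg : PolyTime g) (hf : PolyTime f) : PolyTime fun x => g (f x) := by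
  obtain ⟨S, hS⟩ := hf.size_le
  obtain ⟨p, P, hp⟩ := hf
  obtain ⟨q, R, hq⟩ := hg
  -- The second program runs on `f x`, whose size is at most `S` evaluated at the size of `x`.
  refine ⟨.seq p q, P + R.comp S + 1, fun x => ?_⟩
  obtain ⟨s, hs, hs'⟩ := hp x
  obtain ⟨t, ht, ht'⟩ := hq (f x)
  refine ⟨_, .seq hs ht, ?_⟩
  have := eval_mono R (hS x)
  simp only [Polynomial.eval_add, Polynomial.eval_comp, Polynomial.eval_one]
  omega

protected theorem hd (hf : PolyTime f) : PolyTime fun x => (f x).hd :=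
  PolyTime.comp (g := Data.hd) ⟨.hd, .X, fun x => ⟨_, .hd x, by simp⟩⟩ hf

protected theorem tl (hf : PolyTime f) : PolyTime fun x => (f x).tl :=
  PolyTime.comp (g := Data.tl) ⟨.tl, .X, fun x => ⟨_, .tl x, by simp⟩⟩ hf

protected theorem cons (hf : PolyTime f) (hg : PolyTime g) :
    PolyTime fun x => .cons (f x) (g x) := by
  obtain ⟨p, P, hp⟩ := hf
  obtain ⟨q, R, hq⟩ := hg
  refine ⟨.cons p q, P + R + 1, fun x => ?_⟩
  obtain ⟨s, hs, hs'⟩ := hp x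
  obtain ⟨t, ht, ht'⟩ := hq x
  refine ⟨_, .cons hs ht, ?_⟩
  simp only [Polynomial.eval_add, Polynomial.eval_one]
  omega

protected theorem const (a : Data) : PolyTime fun _ => a := by
  induction a with
  | nil => exact .nil
  | cons a b ha hb => exact ha.cons hb

protected theorem ite {b : Data → Bool} (hb : PolyTimeBool b) (hf : PolyTime f)
    (hg : PolyTime g) : PolyTime fun x => if b x then f x else g x := by
  obtain ⟨c, C, hc⟩ := hb
  obtain ⟨p, P, hp⟩ := hf
  obtain ⟨q, R, hq⟩ := hg
  refine ⟨.ite c p q, C + P + R + 1, fun x => ?_⟩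
  obtain ⟨r, hr, hr'⟩ := hc x
  obtain ⟨s, hs, hs'⟩ := hp x
  obtain ⟨t, ht, ht'⟩ := hq x
  simp only [Polynomial.eval_add, Polynomial.eval_one]
  cases h : b x <;> simp only [h, ofBool] at hr
  · exact ⟨_, .ite_false hr ht, by omega⟩
  · exact ⟨_, .ite_true hr hs, by omega⟩

end PolyTime

namespace PolyTimeBool

variable {b c : Data → Bool}

protected theorem eq {f g : Data → Data} (hf : PolyTime f) (hg : PolyTime g) :
    PolyTimeBool fun x => decide (f x = g x) := by
  have : PolyTime fun x : Data => if x.hd = x.tl then Data.cons .nil .nil else .nil :=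
    ⟨.eq, .X, fun x => ⟨_, .eq x, by simp⟩⟩
  refine (this.comp (hf.cons hg)).of_eq fun x => ?_
  by_cases h : f x = g x <;> simp [ofBool, h]

protected theorem const (b : Bool) : PolyTimeBool fun _ => b := PolyTime.const _

protected theorem ite {d : Data → Bool} (hd : PolyTimeBool d) (hb : PolyTimeBool b)
    (hc : PolyTimeBool c) : PolyTimeBool fun x => if d x then b x else c x := by
  have := PolyTime.ite hd hb hc
  simp only [PolyTimeBool]
  convert this using 2
  split <;> rfl

protected theorem and (hb : PolyTimeBool b) (hc : PolyTimeBool c) :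
    PolyTimeBool fun x => b x && c x := by
  convert hb.ite hc (.const false) using 2 with x
  cases b x <;> rfl

protected theorem or (hb : PolyTimeBool b) (hc : PolyTimeBool c) :
    PolyTimeBool fun x => b x || c x := by
  convert hb.ite (.const true) hc using 2 with x
  cases b x <;> rfl

protected theorem not (hb : PolyTimeBool b) : PolyTimeBool fun x => !b x := by
  convert hb.ite (.const false) (.const true) using 2 with x
  cases b x <;> rfl

protected theorem beq (hb : PolyTimeBool b) (hc : PolyTimeBool c) :
    PolyTimeBool fun x => b x == c x := by
  convert hb.ite hc hc.not using 2 with x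
  cases b x <;> cases c x <;> rfl

end PolyTimeBool

/-- Iteration over a list, with an invariant that relates the remaining elements to the
accumulator and bounds the size of the latter. -/
theorem PolyTime.foldl {l : Data → List Data} {init : Data → Data}
    {step : Data → Data → Data → Data}
    (hl : PolyTimeList l) (hi : PolyTime init)
    (hs : PolyTime fun z => step z.hd z.tl.hd z.tl.tl)
    (I : Data → List Data → Data → Prop) (B : Polynomial ℕ)
    (h0 : ∀ e, I e (l e) (init e))
    (hstep : ∀ e a r acc, a ∈ l e → I e (a :: r) acc → I e r (step a acc e))
    (hB : ∀ e r acc, I e r acc → acc.size ≤ B.eval e.size) :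
    PolyTime fun e => (l e).foldl (fun acc a => step a acc e) (init e) := by
  obtain ⟨S, hS⟩ := hl.size_le
  -- The state of the loop is the triple of the remaining list, the accumulator and the parameter
  -- `e`; this is one pass of its body.
  have hbody : PolyTime fun z =>
      .cons z.hd.tl (.cons (step z.hd.hd z.tl.hd z.tl.tl) z.tl.tl) :=
    PolyTime.id.hd.tl.cons (.cons (hs.comp (PolyTime.id.hd.hd.cons PolyTime.id.tl))
      PolyTime.id.tl.tl)
  obtain ⟨q, R, hq⟩ := hbody
  -- `N` bounds each of the three components, hence 3N + 2 the loop state. A pass costs one test and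
  -- one body; the final test costs twice the size of the state.
  have key : ∀ (e : Data) (N : ℕ), (ofList (l e)).size ≤ N → e.size ≤ N → B.eval e.size ≤ N →
      ∀ (r : List Data) (acc : Data), r <:+ l e → I e r acc → ∃ t,
        (Prog.while .hd q).Runs (.cons (ofList r) (.cons acc e))
          (.cons .nil (.cons (r.foldl (fun acc a => step a acc e) acc) e)) t ∧
        t ≤ (r.length + 1) * (R.eval (3 * N + 2) + 2 * (3 * N + 2) + 1) := by
    intro e N h1 h2 h3 r
    induction r with
    | nil =>
      intro acc _ hI
      refine ⟨_, Prog.Runs.while_stop (.hd _), ?_⟩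
      have := hB _ _ _ hI
      have := e.one_le_size
      simp only [Data.size, List.length_nil, ofList_nil, Nat.zero_add, Nat.one_mul]
      omega
    | cons a r ih =>
      intro acc hr hI
      have hmem : a ∈ l e := hr.subset (by simp)
      have hsuf : r <:+ l e := (List.suffix_cons a r).trans hr
      obtain ⟨t, ht, hle⟩ := ih (step a acc e) hsuf (hstep _ _ _ _ hmem hI)
      have hsz : (Data.cons (ofList (a :: r)) (.cons acc e)).size ≤ 3 * N + 2 := by
        have h4 := hB _ _ _ hI
        have h5 := size_ofList_le_of_sublist hr.sublist
        simp only [Data.size] at *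
        omega
      obtain ⟨u, hu, hule⟩ := hq (.cons (ofList (a :: r)) (.cons acc e))
      refine ⟨_, .while_step (.hd _) hu ht, ?_⟩
      have := eval_mono R hsz
      rw [List.length_cons, Nat.succ_mul (r.length + 1)]
      omega
  have hfull : PolyTime fun e => Data.cons (ofList (l e)) (.cons (init e) e) :=
    PolyTime.cons hl (hi.cons .id)
  have hw : ∃ (p : Prog) (P : Polynomial ℕ), ∀ e, ∃ t,
      p.Runs (.cons (ofList (l e)) (.cons (init e) e))
        (.cons .nil (.cons ((l e).foldl (fun acc a => step a acc e) (init e)) e)) t ∧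
      t ≤ P.eval e.size := by
    refine ⟨.while .hd q,
      (S + 1) * (R.comp (3 * (S + .X + B) + 2) + 2 * (3 * (S + .X + B) + 2) + 1),
      fun e => ?_⟩
    obtain ⟨t, ht, hle⟩ := key e ((S + .X + B).eval e.size)
      (by have := hS e; simp only [Polynomial.eval_add]; omega)
      (by simp only [Polynomial.eval_add, Polynomial.eval_X]; omega)
      (by simp only [Polynomial.eval_add]; omega) (l e) (init e) List.suffix_rfl (h0 e)
    refine ⟨t, ht, hle.trans ?_⟩
    have := (length_le_size (l e)).trans (hS e)
    simp only [Polynomial.eval_add, Polynomial.eval_mul, Polynomial.eval_comp,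
      Polynomial.eval_one, Polynomial.eval_ofNat, Polynomial.eval_X]
    gcongr
  obtain ⟨p₁, P₁, h₁⟩ := hfull
  obtain ⟨p₂, P₂, h₂⟩ := hw
  have : PolyTime fun e =>
      Data.cons .nil (.cons ((l e).foldl (fun acc a => step a acc e) (init e)) e) := by
    refine ⟨.seq p₁ p₂, P₁ + P₂ + 1, fun e => ?_⟩
    obtain ⟨s, hs, hs'⟩ := h₁ e
    obtain ⟨t, ht, ht'⟩ := h₂ e
    refine ⟨_, .seq hs ht, ?_⟩
    simp only [Polynomial.eval_add, Polynomial.eval_one]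
    omega
  exact this.tl.hd

/-- Iteration over a list where each step adds a bounded amount to the size of the accumulator. -/
theorem PolyTime.foldl_of_size_le {l : Data → List Data} {init : Data → Data}
    {step : Data → Data → Data → Data} (hl : PolyTimeList l) (hi : PolyTime init)
    (hs : PolyTime fun z => step z.hd z.tl.hd z.tl.tl) (C : Polynomial ℕ)
    (hC : ∀ e a acc, a ∈ l e → (step a acc e).size ≤ acc.size + C.eval (a.size + e.size)) :
    PolyTime fun e => (l e).foldl (fun acc a => step a acc e) (init e) := by
  obtain ⟨S, hS⟩ := hl.size_le
  obtain ⟨T, hT⟩ := hi.size_le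
  refine PolyTime.foldl hl hi hs
    -- A potential: the size reached so far plus all that the remaining steps can still add.
    (fun e r acc => acc.size + r.length * C.eval (S.eval e.size + e.size) ≤
      T.eval e.size + S.eval e.size * C.eval (S.eval e.size + e.size))
    (T + S * C.comp (S + .X)) ?_ ?_ ?_
  · intro e
    have h1 := hT e
    have h2 := (length_le_size (l e)).trans (hS e)
    gcongr
  · intro e a r acc ha h
    have h1 := hC e a acc ha
    have h2 := eval_mono C (Nat.add_le_add_right ((size_le_of_mem ha).trans (hS e)) e.size)
    simp only [List.length_cons, Nat.succ_mul] at h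
    omega
  · intro e r acc h
    simp only [Polynomial.eval_add, Polynomial.eval_mul, Polynomial.eval_comp, Polynomial.eval_X]
    omega

/-! ### Polynomial-time operations on lists -/

namespace PolyTimeList

variable {l m : Data → List Data}

theorem toList {f : Data → Data} (hf : PolyTime f) : PolyTimeList fun e => (f e).toList := by
  simpa [PolyTimeList] using hf

protected theorem nil : PolyTimeList fun _ => [] := PolyTime.nil

protected theorem cons {f : Data → Data} (hf : PolyTime f) (hl : PolyTimeList l) :
    PolyTimeList fun e => f e :: l e := PolyTime.cons hf hl

protected theorem ite {b : Data → Bool} (hb : PolyTimeBool b) (hl : PolyTimeList l)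
    (hm : PolyTimeList m) : PolyTimeList fun e => if b e then l e else m e := by
  have := PolyTime.ite hb hl hm
  simp only [PolyTimeList]
  convert this using 2
  split <;> rfl

protected theorem reverse (hl : PolyTimeList l) : PolyTimeList fun e => (l e).reverse := by
  have := PolyTime.foldl_of_size_le (step := fun a acc _ => .cons a acc) hl .nil
    (PolyTime.id.hd.cons PolyTime.id.tl.hd) (.X + 1)
    (fun e a acc _ => by simp [Data.size]; omega)
  refine this.of_eq fun e => ?_
  dsimp only
  have h : ∀ (s t : List Data), ofList (s.reverse ++ t) =
      s.foldl (fun acc a => .cons a acc) (ofList t) := by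
    intro s
    induction s with
    | nil => simp
    | cons a s ih => intro t; simpa using ih (a :: t)
  simpa using h (l e) []

protected theorem append (hl : PolyTimeList l) (hm : PolyTimeList m) :
    PolyTimeList fun e => l e ++ m e := by
  have := PolyTime.foldl_of_size_le (step := fun a acc _ => .cons a acc) hl.reverse hm
    (PolyTime.id.hd.cons PolyTime.id.tl.hd) (.X + 1)
    (fun e a acc _ => by simp [Data.size]; omega)
  refine this.of_eq fun e => ?_
  dsimp only
  rw [List.foldl_reverse]
  generalize l e = s
  induction s with
  | nil => rfl
  | cons a s ih => simp [ih]

protected theorem flatMap {g : Data → Data → List Data} (hl : PolyTimeList l)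
    (hg : PolyTimeList fun z => g z.hd z.tl) :
    PolyTimeList fun e => (l e).flatMap fun a => g a e := by
  obtain ⟨P, hP⟩ := hg.size_le
  have hg' : PolyTimeList fun z => g z.hd z.tl.tl :=
    PolyTime.comp hg (PolyTime.id.hd.cons PolyTime.id.tl.tl)
  -- Each step puts its contribution in front, so the list is traversed in reverse.
  have := PolyTime.foldl_of_size_le (step := fun a acc e => ofList (g a e ++ acc.toList))
    hl.reverse .nil (hg'.append (.toList PolyTime.id.tl.hd)) (P.comp (.X + 1))
    (fun e a acc _ => by
      have h1 := hP (.cons a e)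
      have h2 := size_ofList_append (g a e) acc.toList
      simp only [ofList_toList, Data.size, hd_cons, tl_cons] at h1 h2
      simp only [Polynomial.eval_comp, Polynomial.eval_add, Polynomial.eval_X, Polynomial.eval_one]
      omega)
  refine this.of_eq fun e => ?_
  dsimp only
  rw [List.foldl_reverse]
  generalize l e = s
  induction s with
  | nil => rfl
  | cons a s ih => simp [List.flatMap_cons, ← ih]

protected theorem map {g : Data → Data → Data} (hl : PolyTimeList l)
    (hg : PolyTime fun z => g z.hd z.tl) : PolyTimeList fun e => (l e).map fun a => g a e := by
  refine (hl.flatMap (g := fun a e => [g a e]) (.cons hg .nil)).of_eq fun e => ?_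
  dsimp only
  rw [List.map_eq_flatMap]

protected theorem filter {g : Data → Data → Bool} (hl : PolyTimeList l)
    (hg : PolyTimeBool fun z => g z.hd z.tl) :
    PolyTimeList fun e => (l e).filter fun a => g a e := by
  refine (hl.flatMap (g := fun a e => if g a e then [a] else [])
    (.ite hg (.cons PolyTime.id.hd .nil) .nil)).of_eq fun e => ?_
  dsimp only
  congr 1
  generalize l e = s
  induction s with
  | nil => rfl
  | cons a s ih => simp only [List.filter_cons, List.flatMap_cons, ih]; split <;> rfl

/-- All pairs of an element of the first list and an element of the second. -/
def _root_.VSet.Data.pairs (l m : List Data) : List Data :=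
  l.flatMap fun a => m.map fun b => .cons a b

protected theorem pairs (hl : PolyTimeList l) (hm : PolyTimeList m) :
    PolyTimeList fun e => pairs (l e) (m e) :=
  hl.flatMap (g := fun a e => (m e).map fun b => .cons a b)
    (PolyTimeList.map (g := fun b z => .cons z.hd b) (PolyTime.comp hm PolyTime.id.tl)
      (PolyTime.id.tl.hd.cons PolyTime.id.hd))

/-- The suffixes of a list of trees, as trees. -/
def _root_.VSet.Data.suffixes (l : List Data) : List Data := l.tails.map ofList

protected theorem suffixes (hl : PolyTimeList l) : PolyTimeList fun e => suffixes (l e) := by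
  obtain ⟨S, hS⟩ := hl.size_le
  have h := PolyTime.foldl (l := fun e => (l e).reverse)
    (step := fun a acc _ => .cons (.cons a acc.hd) acc) hl.reverse
    (.const (.cons .nil .nil))
    (.cons (PolyTime.id.hd.cons PolyTime.id.tl.hd.hd) PolyTime.id.tl.hd)
    -- The accumulator lists the suffixes of the consumed part `s`. Its head is `s` itself, to which
    -- the next element is prepended. The increments are not bounded independently of `acc`, hence
    -- the explicit invariant.
    (fun e r acc => ∃ s, r.reverse ++ s = l e ∧ acc = ofList (suffixes s))
    ((S + 1) * (S + 2))
    (fun e => ⟨[], by simp, rfl⟩)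
    (by
      rintro e a r acc - ⟨s, hs, rfl⟩
      refine ⟨a :: s, by simpa using hs, ?_⟩
      cases s <;> simp [suffixes, List.tails])
    (by
      rintro e r acc ⟨s, hs, rfl⟩
      have h1 : ∀ t : List Data, t <:+ s → (ofList (suffixes t)).size ≤
          (t.length + 1) * ((ofList s).size + 2) := by
        intro t
        induction t with
        | nil =>
          intro _
          have := (ofList s).one_le_size
          simp [suffixes, Data.size]
          omega
        | cons a t ih =>
          intro ht
          have h2 := ih ((List.suffix_cons a t).trans ht)
          have h3 := size_ofList_le_of_sublist ht.sublist
          simp only [suffixes, List.tails, List.map_cons, ofList_cons, Data.size,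
            List.length_cons] at h2 h3 ⊢
          rw [Nat.succ_mul (t.length + 1)]
          omega
      have h2 : s.length ≤ S.eval e.size := by
        have := (length_le_size (l e)).trans (hS e)
        rw [← hs] at this
        simp at this
        omega
      have h3 : (ofList s).size ≤ S.eval e.size := by
        refine (size_ofList_le_of_sublist ?_).trans (hS e)
        rw [← hs]
        exact List.sublist_append_right _ _
      refine (h1 s List.suffix_rfl).trans ?_
      simp only [Polynomial.eval_add, Polynomial.eval_mul, Polynomial.eval_one,
        Polynomial.eval_ofNat]
      gcongr)
  refine h.of_eq fun e => ?_
  dsimp only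
  rw [List.foldl_reverse]
  generalize l e = s
  induction s with
  | nil => rfl
  | cons a s ih =>
    rw [List.foldr_cons, ← ih]
    cases s <;> simp [suffixes, List.tails]

end PolyTimeList

protected theorem PolyTimeBool.any {l : Data → List Data} {g : Data → Data → Bool}
    (hl : PolyTimeList l) (hg : PolyTimeBool fun z => g z.hd z.tl) :
    PolyTimeBool fun e => (l e).any fun a => g a e := by
  refine (PolyTimeBool.eq (hl.filter hg) .nil).not.of_eq fun e => ?_
  dsimp only
  congr 1
  rw [Bool.eq_iff_iff]
  simp only [List.any_eq_true, Bool.not_eq_true', decide_eq_false_iff_not,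
    ofList_injective.eq_iff (b := []), ← ofList_nil, List.filter_eq_nil_iff, not_forall, not_not,
    exists_prop]

protected theorem PolyTimeBool.all {l : Data → List Data} {g : Data → Data → Bool}
    (hl : PolyTimeList l) (hg : PolyTimeBool fun z => g z.hd z.tl) :
    PolyTimeBool fun e => (l e).all fun a => g a e := by
  refine (PolyTimeBool.any (g := fun a e => !g a e) hl hg.not).not.of_eq fun e => ?_
  simp only [List.not_any_eq_all_not, Bool.not_not]

protected theorem PolyTimeBool.mem {f : Data → Data} {l : Data → List Data} (hf : PolyTime f)
    (hl : PolyTimeList l) : PolyTimeBool fun e => decide (f e ∈ l e) := by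
  refine (PolyTimeBool.any hl (g := fun a e => decide (a = f e))
    (.eq PolyTime.id.hd (hf.comp PolyTime.id.tl))).of_eq fun e => ?_
  dsimp only
  simp [List.any_eq]

/-- A list without its repetitions. -/
def Data.dedup (l : List Data) : List Data :=
  l.foldl (fun acc a => if a ∈ acc then acc else a :: acc) []

protected theorem PolyTimeList.dedup {l : Data → List Data} (hl : PolyTimeList l) :
    PolyTimeList fun e => Data.dedup (l e) := by
  have := PolyTime.foldl_of_size_le
    (step := fun a acc _ => if decide (a ∈ acc.toList) then acc else .cons a acc) hl .nil
    (.ite (.mem PolyTime.id.hd (.toList PolyTime.id.tl.hd)) PolyTime.id.tl.hd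
      (PolyTime.id.hd.cons PolyTime.id.tl.hd)) (.X + 1)
    (fun e a acc _ => by split <;> simp [Data.size]; omega)
  refine this.of_eq fun e => ?_
  dsimp only
  have h : ∀ (s t : List Data),
      ofList (s.foldl (fun acc a => if a ∈ acc then acc else a :: acc) t) = s.foldl
        (fun acc a => if decide (a ∈ acc.toList) then acc else .cons a acc) (ofList t) := by
    intro s
    induction s with
    | nil => simp
    | cons a s ih =>
      intro t
      rw [List.foldl_cons, List.foldl_cons, ih]
      by_cases h : a ∈ t <;> simp [h]
  exact h _ []

end VSet

namespace VSet

/-! ### Boolean weights and their supports -/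

namespace BoolSR

theorem ne_zero_iff {x : BoolSR} : x ≠ 0 ↔ x = 1 := by
  cases x
  · exact ⟨fun h => absurd rfl h, fun h => BoolSR.noConfusion h⟩
  · exact ⟨fun _ => rfl, fun _ h => BoolSR.noConfusion h⟩

instance instNontrivial : Nontrivial BoolSR := ⟨⟨.ff, .tt, fun h => BoolSR.noConfusion h⟩⟩

/-- Hence the weight of a run never vanishes, and an entry of a join is nonzero exactly if both
factors are. -/
instance instNoZeroDivisors : NoZeroDivisors BoolSR where
  eq_zero_or_eq_zero_of_mul_eq_zero := by
    rintro (_ | _) (_ | _) h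
    · exact .inl rfl
    · exact .inl rfl
    · exact .inr rfl
    · exact BoolSR.noConfusion h

theorem add_ne_zero_iff {x y : BoolSR} : x + y ≠ 0 ↔ x ≠ 0 ∨ y ≠ 0 := by
  cases x
  · exact ⟨fun h => .inr h, fun h => h.resolve_left fun h => h rfl⟩
  · exact ⟨fun h => .inl h, fun _ h => BoolSR.noConfusion h⟩

/-- Reduces the equality of annotators to that of their supports. -/
theorem eq_of_ne_zero_iff {x y : BoolSR} (h : x ≠ 0 ↔ y ≠ 0) : x = y := by
  by_cases hx : x = 0
  · rw [hx]
    by_contra hy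
    exact h.2 (Ne.symm hy) hx
  · rw [ne_zero_iff.1 hx, ne_zero_iff.1 (h.1 hx)]

/-- Addition is disjunction, so nothing cancels. -/
theorem sum_ne_zero_iff {ι : Type*} (s : Finset ι) (f : ι → BoolSR) :
    ∑ i ∈ s, f i ≠ 0 ↔ ∃ i ∈ s, f i ≠ 0 := by
  classical
  induction s using Finset.induction_on with
  | empty => simp
  | insert a s ha ih => rw [Finset.sum_insert ha, add_ne_zero_iff, ih]; simp

end BoolSR

/-! ### Words of labels: position, order and multiplicity of operations -/

section Words

variable {Alph Var : Type} {V : Finset Var}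

/-- The variable operation performed by a label, if any: `(false, v)` stands for opening `v` and
`(true, v)` for closing it. -/
def Label.op? : Label Alph V → Option (Bool × Var)
  | .opn v => some (false, v)
  | .cls v => some (true, v)
  | _ => none

/-- The letters read by a list of labels. -/
abbrev letters (w : List (Label Alph V)) : List Alph := w.filterMap Label.letter?

/-- The variable operations performed by a list of labels. -/
abbrev ops (w : List (Label Alph V)) : List (Bool × Var) := w.filterMap Label.op?

theorem Label.mem_of_op? {o : Label Alph V} {μ : Bool × Var} (h : o.op? = some μ) : μ.2 ∈ V := by
  cases o with
  | opn v => cases h; exact v.2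
  | cls v => cases h; exact v.2
  | _ => cases h

theorem Label.op?_inj {o o' : Label Alph V} {μ : Bool × Var} (h : o.op? = some μ)
    (h' : o'.op? = some μ) : o = o' := by
  cases o <;> cases o' <;> simp only [Label.op?, Option.some.injEq, reduceCtorEq] at h h'
  · rw [Subtype.ext (congrArg Prod.snd (h.trans h'.symm))]
  · exact absurd (congrArg Prod.fst (h.trans h'.symm)) (by simp)
  · exact absurd (congrArg Prod.fst (h.trans h'.symm)) (by simp)
  · rw [Subtype.ext (congrArg Prod.snd (h.trans h'.symm))]

theorem mem_of_mem_ops {w : List (Label Alph V)} {μ : Bool × Var} (h : μ ∈ ops w) : μ.2 ∈ V := by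
  obtain ⟨o, -, ho⟩ := List.mem_filterMap.1 h
  exact Label.mem_of_op? ho

theorem mem_ops_iff {w : List (Label Alph V)} {o : Label Alph V} {μ : Bool × Var}
    (h : o.op? = some μ) : μ ∈ ops w ↔ o ∈ w := by
  rw [List.mem_filterMap]
  exact ⟨fun ⟨o', h', h''⟩ => Label.op?_inj h'' h ▸ h', fun h' => ⟨o, h', h⟩⟩

/-- The operation `μ` is performed after reading exactly `n` letters. -/
def OpAt (μ : Bool × Var) (w : List (Label Alph V)) (n : ℕ) : Prop :=
  ∃ u o u', w = u ++ o :: u' ∧ o.op? = some μ ∧ (letters u).length = n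

/-- The operation `μ` is performed before the operation `ν`. -/
def Before (μ ν : Bool × Var) (w : List (Label Alph V)) : Prop :=
  ∃ u o u', w = u ++ o :: u' ∧ o.op? = some μ ∧ ν ∈ ops u'

variable {μ ν : Bool × Var} {o : Label Alph V} {w b : List (Label Alph V)} {n : ℕ}

theorem exists_opAt_iff : (∃ n, OpAt μ w n) ↔ μ ∈ ops w := by
  rw [List.mem_filterMap]
  constructor
  · rintro ⟨n, u, o, u', rfl, h, -⟩
    exact ⟨o, by simp, h⟩
  · rintro ⟨o, h, ho⟩
    obtain ⟨u, u', rfl⟩ := List.append_of_mem h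
    exact ⟨_, u, o, u', rfl, ho, rfl⟩

theorem not_opAt_nil : ¬ OpAt μ ([] : List (Label Alph V)) n := by
  rintro ⟨u, o, u', h, -⟩
  simp at h

theorem opAt_cons : OpAt μ (o :: w) n ↔
    (o.op? = some μ ∧ n = 0) ∨ ∃ m, OpAt μ w m ∧ n = (letters [o]).length + m := by
  constructor
  · rintro ⟨u, o', u', h, h', rfl⟩
    cases u with
    | nil =>
      obtain ⟨rfl, rfl⟩ := List.cons.inj h
      exact .inl ⟨h', rfl⟩
    | cons x u =>
      obtain ⟨rfl, rfl⟩ := List.cons.inj h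
      refine .inr ⟨_, ⟨u, o', u', rfl, h', rfl⟩, ?_⟩
      rw [← List.length_append, ← List.filterMap_append]
      rfl
  · rintro (⟨h, rfl⟩ | ⟨m, ⟨u, o', u', rfl, h', rfl⟩, rfl⟩)
    · exact ⟨[], o, w, rfl, h, rfl⟩
    · refine ⟨o :: u, o', u', rfl, h', ?_⟩
      rw [← List.length_append, ← List.filterMap_append]
      rfl

/-- A letter-free prefix has all its operations at position 0 and does not shift those that follow.
-/
theorem opAt_append (hb : letters b = []) :
    OpAt μ (b ++ w) n ↔ (μ ∈ ops b ∧ n = 0) ∨ OpAt μ w n := by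
  induction b generalizing n with
  | nil => simp
  | cons x b ih =>
    have hx : letters [x] = [] ∧ letters b = [] := by
      rw [← List.append_eq_nil_iff, ← List.filterMap_append]; exact hb
    have ih := fun m => ih (n := m) hx.2
    rw [List.cons_append, opAt_cons, hx.1]
    simp only [ih, List.length_nil, zero_add]
    have : μ ∈ ops (x :: b) ↔ x.op? = some μ ∨ μ ∈ ops b := by
      simp [List.mem_filterMap]
    rw [this]
    constructor
    · rintro (h | ⟨m, h, rfl⟩) <;> tauto
    · rintro (⟨h | h, rfl⟩ | h)
      · exact .inl ⟨h, rfl⟩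
      · exact .inr ⟨_, .inl ⟨h, rfl⟩, rfl⟩
      · exact .inr ⟨_, .inr h, rfl⟩

theorem opAt_letter_cons {a : Alph} :
    OpAt μ (Label.letter a :: w) n ↔ ∃ m, OpAt μ w m ∧ n = m + 1 := by
  rw [opAt_cons]
  simp [Label.op?, letters, Label.letter?, add_comm]

theorem opAt_of_letters_eq_nil (hb : letters b = []) : OpAt μ b n ↔ μ ∈ ops b ∧ n = 0 := by
  have := opAt_append (μ := μ) (n := n) (w := []) hb
  simpa [not_opAt_nil] using this

theorem not_before_nil : ¬ Before μ ν ([] : List (Label Alph V)) := by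
  rintro ⟨u, o, u', h, -⟩
  simp at h

theorem before_cons : Before μ ν (o :: w) ↔ (o.op? = some μ ∧ ν ∈ ops w) ∨ Before μ ν w := by
  constructor
  · rintro ⟨u, o', u', h, h', h''⟩
    cases u with
    | nil =>
      obtain ⟨rfl, rfl⟩ := List.cons.inj h
      exact .inl ⟨h', h''⟩
    | cons x u =>
      obtain ⟨rfl, rfl⟩ := List.cons.inj h
      exact .inr ⟨u, o', u', rfl, h', h''⟩
  · rintro (⟨h, h'⟩ | ⟨u, o', u', rfl, h', h''⟩)
    · exact ⟨[], o, w, rfl, h, h'⟩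
    · exact ⟨o :: u, o', u', rfl, h', h''⟩

theorem before_append :
    Before μ ν (b ++ w) ↔ Before μ ν b ∨ (μ ∈ ops b ∧ ν ∈ ops w) ∨ Before μ ν w := by
  induction b with
  | nil => simp [not_before_nil]
  | cons x b ih =>
    rw [List.cons_append, before_cons, ih, before_cons]
    have h1 : μ ∈ ops (x :: b) ↔ x.op? = some μ ∨ μ ∈ ops b := by
      simp [List.mem_filterMap]
    have h2 : ν ∈ ops (b ++ w) ↔ ν ∈ ops b ∨ ν ∈ ops w := by
      rw [ops, List.filterMap_append, List.mem_append]
    rw [h1, h2]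
    tauto

/-- The label `o` occurs in `w` exactly at the index `i`. -/
def OnlyAt (o : Label Alph V) (w : List (Label Alph V)) (i : ℕ) : Prop :=
  ∀ k, w[k]? = some o ↔ k = i

/-- Validity is defined by indices; multiplicities are additive under concatenation and thus better
suited to cutting runs into blocks. `exists_onlyAt` is the way back. -/
theorem OnlyAt.count [BEq (Bool × Var)] [LawfulBEq (Bool × Var)] {i : ℕ} (h : OnlyAt o w i)
    (ho : o.op? = some μ) : (ops w).count μ = 1 := by
  induction w generalizing i with
  | nil => have := (h i).2 rfl; simp at this
  | cons x w ih =>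
    rw [← List.singleton_append, ops, List.filterMap_append, List.count_append]
    cases i with
    | zero =>
      have hx : x = o := by simpa using (h 0).2 rfl
      have hw : o ∉ w := by
        intro hw
        obtain ⟨k, hk⟩ := List.mem_iff_getElem?.1 hw
        have := (h (k + 1)).1 (by simpa using hk)
        omega
      rw [← mem_ops_iff ho] at hw
      rw [List.count_eq_zero_of_not_mem hw, hx]
      simp [ho]
    | succ i =>
      have hw : OnlyAt o w i := fun k => by
        have := h (k + 1)
        simpa using this
      have hx : x ≠ o := by
        intro hx
        have := (h 0).1 (by simp [hx])
        omega
      have : μ ∉ ops [x] := by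
        rw [mem_ops_iff ho]; simpa using Ne.symm hx
      have h1 := ih hw
      rw [ops] at h1
      rw [List.count_eq_zero_of_not_mem this, h1]

theorem exists_onlyAt [BEq (Bool × Var)] [LawfulBEq (Bool × Var)] (ho : o.op? = some μ)
    (h : (ops w).count μ = 1) : ∃ i, OnlyAt o w i := by
  induction w with
  | nil => simp at h
  | cons x w ih =>
    rw [← List.singleton_append, ops, List.filterMap_append, List.count_append] at h
    by_cases hx : x = o
    · have hw : o ∉ w := by
        have h1 : (List.filterMap Label.op? [x]).count μ = 1 := by simp [hx, ho]
        rw [← mem_ops_iff ho, ← List.count_eq_zero, ops]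
        omega
      refine ⟨0, fun k => ?_⟩
      cases k with
      | zero => simp [hx]
      | succ k =>
        simp only [List.getElem?_cons_succ, Nat.add_eq_zero_iff, one_ne_zero, and_false, iff_false]
        exact fun h' => hw (List.mem_iff_getElem?.2 ⟨k, h'⟩)
    · have : μ ∉ ops [x] := by
        rw [mem_ops_iff ho]; simpa using Ne.symm hx
      have h1 : (List.filterMap Label.op? [x]).count μ = 0 := List.count_eq_zero.2 this
      obtain ⟨i, hi⟩ := ih (by rw [ops]; omega)
      refine ⟨i + 1, fun k => ?_⟩
      cases k with
      | zero => simp [hx]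
      | succ k => simpa using hi k

theorem OnlyAt.opAt_iff {i : ℕ} (h : OnlyAt o w i) (ho : o.op? = some μ) :
    OpAt μ w n ↔ n = (letters (w.take i)).length := by
  constructor
  · rintro ⟨u, o', u', rfl, h', rfl⟩
    obtain rfl := Label.op?_inj h' ho
    obtain rfl := (h u.length).1 (by simp)
    simp
  · rintro rfl
    have hi := (h i).2 rfl
    obtain ⟨hlt, hi⟩ := List.getElem?_eq_some_iff.1 hi
    refine ⟨w.take i, o, w.drop (i + 1), ?_, ho, rfl⟩
    rw [← hi, List.getElem_cons_drop, List.take_append_drop]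

theorem OnlyAt.idxOf [DecidableEq (Label Alph V)] {i : ℕ} (h : OnlyAt o w i) : w.idxOf o = i := by
  have hm : o ∈ w := List.mem_iff_getElem?.2 ⟨i, (h i).2 rfl⟩
  refine (h _).1 ?_
  have := List.idxOf_lt_length_iff.2 hm
  rw [List.getElem?_eq_getElem this, List.getElem_idxOf]

end Words

/-! ### Validity, tuples and annotators in terms of words -/

namespace Automaton

variable {Alph Var : Type} {V : Finset Var} {A : Automaton BoolSR Alph V}

-- Validity in a form without indices, which can be checked on concatenations.
open Classical in
theorem Run.valid_iff {d : List Alph} {ρ : A.Run d} : ρ.Valid ↔ ∀ v ∈ V,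
    (ops ρ.labels).count (false, v) = 1 ∧ (ops ρ.labels).count (true, v) = 1 ∧
      ¬ Before (true, v) (false, v) ρ.labels := by
  constructor
  · intro h v hv
    obtain ⟨i, j, hij, hi, hj⟩ := h ⟨v, hv⟩
    refine ⟨OnlyAt.count (i := i) hi rfl, OnlyAt.count (i := j) hj rfl, ?_⟩
    rintro ⟨u, o, u', hw, ho, hu'⟩
    obtain rfl := Label.op?_inj ho (show (Label.cls (Alph := Alph) ⟨v, hv⟩).op? = _ from rfl)
    have h1 := (hj u.length).1 (by simp [hw])
    rw [mem_ops_iff (o := Label.opn ⟨v, hv⟩) rfl] at hu'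
    obtain ⟨k, hk⟩ := List.mem_iff_getElem?.1 hu'
    -- The index `k` in `u'` is shifted by the length of `u` and by the closing label itself.
    have h2 := (hi (u.length + (k + 1))).1 (by rw [hw]; simpa [List.getElem?_append_right] using hk)
    omega
  · rintro h ⟨v, hv⟩
    obtain ⟨h1, h2, h3⟩ := h v hv
    obtain ⟨i, hi⟩ := exists_onlyAt (o := Label.opn ⟨v, hv⟩) rfl h1
    obtain ⟨j, hj⟩ := exists_onlyAt (o := Label.cls ⟨v, hv⟩) rfl h2
    refine ⟨i, j, ?_, hi, hj⟩
    by_contra hij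
    have h4 : j ≠ i := by
      rintro rfl
      have := ((hi j).2 rfl).symm.trans ((hj j).2 rfl)
      simp at this
    have hj' := (hj j).2 rfl
    obtain ⟨hlt, hjeq⟩ := List.getElem?_eq_some_iff.1 hj'
    refine h3 ⟨ρ.labels.take j, .cls ⟨v, hv⟩, ρ.labels.drop (j + 1), ?_, rfl, ?_⟩
    · rw [← hjeq, List.getElem_cons_drop, List.take_append_drop]
    · rw [mem_ops_iff (o := Label.opn ⟨v, hv⟩) rfl]
      refine List.mem_iff_getElem?.2 ⟨i - (j + 1), ?_⟩
      rw [List.getElem?_drop, show j + 1 + (i - (j + 1)) = i by omega]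
      exact (hi i).2 rfl

-- `OpAt` counts the letters read, from 0, while spans count positions from 1; hence the successor.
open Classical in
theorem Run.Valid.opAt_opn {d : List Alph} {ρ : A.Run d} (h : ρ.Valid) (v : V) (n : ℕ) :
    OpAt (false, v.1) ρ.labels n ↔ n + 1 = (ρ.tuple v).1 := by
  obtain ⟨i, j, -, hi, -⟩ := h v
  rw [OnlyAt.opAt_iff (o := Label.opn v) hi rfl, Run.tuple, OnlyAt.idxOf hi]
  simp [Run.pos]

open Classical in
theorem Run.Valid.opAt_cls {d : List Alph} {ρ : A.Run d} (h : ρ.Valid) (v : V) (n : ℕ) :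
    OpAt (true, v.1) ρ.labels n ↔ n + 1 = (ρ.tuple v).2 := by
  obtain ⟨i, j, -, -, hj⟩ := h v
  rw [OnlyAt.opAt_iff (o := Label.cls v) hj rfl, Run.tuple, OnlyAt.idxOf hj]
  simp [Run.pos]

/-- The operations of valid runs occur at the same positions if and only if their tuples agree. -/
theorem Run.Valid.tuple_apply_eq_iff {V' : Finset Var} {A' : Automaton BoolSR Alph V'}
    {d d' : List Alph} {ρ : A.Run d} {ρ' : A'.Run d'} (h : ρ.Valid) (h' : ρ'.Valid)
    (v : Var) (hv : v ∈ V) (hv' : v ∈ V') : ρ.tuple ⟨v, hv⟩ = ρ'.tuple ⟨v, hv'⟩ ↔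
      ∀ c n, OpAt (c, v) ρ.labels n ↔ OpAt (c, v) ρ'.labels n := by
  have h1 := h.opAt_opn ⟨v, hv⟩
  have h2 := h.opAt_cls ⟨v, hv⟩
  have h3 := h'.opAt_opn ⟨v, hv'⟩
  have h4 := h'.opAt_cls ⟨v, hv'⟩
  simp only at h1 h2 h3 h4
  constructor
  · intro heq c n
    cases c
    · rw [h1, h3, heq]
    · rw [h2, h4, heq]
  · intro heq
    refine Prod.ext ?_ ?_
    -- `pos` is a successor by definition, so subtracting 1 and adding it again is the identity
    -- definitionally.
    · exact (h3 _).1 ((heq false _).1 ((h1 (ρ.pos _ - 1)).2 rfl))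
    · exact (h4 _).1 ((heq true _).1 ((h2 (ρ.pos _ - 1)).2 rfl))

theorem pathWeight_ne_zero {q : A.Q} {s : List (Label Alph V × A.Q)} (h : A.IsPath q s) :
    A.pathWeight q s ≠ 0 := by
  induction s generalizing q with
  | nil => exact h
  | cons x s ih => exact mul_ne_zero h.1 (ih h.2)

theorem Run.weight_ne_zero {d : List Alph} (ρ : A.Run d) : ρ.weight ≠ 0 :=
  mul_ne_zero ρ.init_ne (pathWeight_ne_zero ρ.isPath)

theorem Run.ext {d : List Alph} {ρ ρ' : A.Run d} (h : ρ.start = ρ'.start)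
    (h' : ρ.steps = ρ'.steps) : ρ = ρ' := by
  cases ρ; cases ρ'; cases h; cases h'; rfl

theorem finite_label [Finite Alph] : Finite (Label Alph V) := by
  refine Finite.of_injective (β := Option (Alph ⊕ V ⊕ V)) (fun
    | .eps => none
    | .letter a => some (.inl a)
    | .opn v => some (.inr (.inl v))
    | .cls v => some (.inr (.inr v))) ?_
  intro o o' h
  cases o <;> cases o' <;> simp_all

/-- On a finite set, a transitive irreflexive relation is well-founded; it is applied to the
transitive closure of the ε-steps, reversed so that induction proceeds from targets to sources. -/
theorem wellFounded_eps (A : Automaton BoolSR Alph V) :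
    WellFounded fun p' p => A.δ p Label.eps p' ≠ 0 := by
  have := A.finite_Q
  have h : WellFounded fun p' p => Relation.TransGen (fun p p' => A.δ p Label.eps p' ≠ 0) p p' := by
    have : IsTrans A.Q fun p' p => Relation.TransGen (fun p p' => A.δ p Label.eps p' ≠ 0) p p' :=
      ⟨fun _ _ _ h h' => h'.trans h⟩
    have : Std.Irrefl fun p' p => Relation.TransGen (fun p p' => A.δ p Label.eps p' ≠ 0) p p' :=
      ⟨A.no_eps_cycle⟩
    exact Finite.wellFounded_of_trans_of_irrefl _
  exact Subrelation.wf (fun h' => .single h') h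

/-- Steps other than ε lower the budget `m`; ε-steps keep it but descend in a well-founded relation.
This gives two nested inductions, and each state has finitely many successors. -/
theorem finite_paths [Finite Alph] (A : Automaton BoolSR Alph V) (m : ℕ) (q : A.Q) :
    {s | A.IsPath q s ∧
      (letters (s.map Prod.fst)).length + (ops (s.map Prod.fst)).length ≤ m}.Finite := by
  have := A.finite_Q
  have : Finite (Label Alph V) := finite_label
  induction m generalizing q with
  | zero =>
    induction q using A.wellFounded_eps.induction with
    | _ q ih =>
      refine ((Set.finite_iUnion fun r : {r // A.δ q .eps r ≠ 0} =>
        (ih r.1 r.2).image (fun s => (Label.eps, r.1) :: s)).insert []).subset ?_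
      rintro (_ | ⟨⟨o, r⟩, s⟩) ⟨h, h'⟩
      · exact .inl rfl
      · refine .inr ?_
        cases o with
        | eps => exact Set.mem_iUnion.2 ⟨⟨r, h.1⟩, s, ⟨h.2, h'⟩, rfl⟩
        | _ => simp [Label.letter?, Label.op?] at h'
  | succ m ihm =>
    induction q using A.wellFounded_eps.induction with
    | _ q ih =>
      refine (((Set.finite_iUnion fun r : {r // A.δ q .eps r ≠ 0} =>
        (ih r.1 r.2).image (fun s => (Label.eps, r.1) :: s)).union
        (Set.finite_iUnion fun x : Label Alph V × A.Q =>
          (ihm x.2).image (fun s => x :: s))).insert []).subset ?_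
      rintro (_ | ⟨⟨o, r⟩, s⟩) ⟨h, h'⟩
      · exact .inl rfl
      · refine .inr ?_
        cases o with
        | eps => exact .inl (Set.mem_iUnion.2 ⟨⟨r, h.1⟩, s, ⟨h.2, h'⟩, rfl⟩)
        | _ =>
          refine .inr (Set.mem_iUnion.2 ⟨(_, r), s, ⟨h.2, ?_⟩, rfl⟩)
          simp only [List.map_cons, letters, ops, List.filterMap_cons, Label.letter?, Label.op?,
            List.length_cons] at h' ⊢
          omega

/-- A valid run reads |d| letters and performs at most 2|V| operations. Finiteness matters because a
`finsum` with infinite support would be 0. -/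
theorem finite_valid_runs [Finite Alph] (A : Automaton BoolSR Alph V) (d : List Alph) :
    {ρ : A.Run d | ρ.Valid}.Finite := by
  classical
  have := A.finite_Q
  have hfin : (⋃ q : A.Q, (fun s => (q, s)) '' {s | A.IsPath q s ∧
      (letters (s.map Prod.fst)).length + (ops (s.map Prod.fst)).length ≤
        d.length + 2 * V.card}).Finite :=
    Set.finite_iUnion fun q => (finite_paths A _ q).image _
  refine Set.Finite.of_finite_image (f := fun ρ : A.Run d => (ρ.start, ρ.steps))
    (hfin.subset ?_) (fun ρ _ ρ' _ h => Run.ext (congrArg Prod.fst h) (congrArg Prod.snd h))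
  rintro _ ⟨ρ, hρ, rfl⟩
  refine Set.mem_iUnion.2 ⟨ρ.start, ρ.steps, ⟨ρ.isPath, ?_⟩, rfl⟩
  have h1 : letters (ρ.steps.map Prod.fst) = d := ρ.reads
  have h2 : (ops (ρ.steps.map Prod.fst)).Nodup := by
    rw [List.nodup_iff_count_le_one]
    rintro ⟨c, v⟩
    by_cases hv : v ∈ V
    · obtain ⟨h3, h4, -⟩ := Run.valid_iff.1 hρ v hv
      cases c
      · exact h3.le
      · exact h4.le
    · rw [List.count_eq_zero_of_not_mem fun h => hv (mem_of_mem_ops h)]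
      omega
  have h3 : (ops (ρ.steps.map Prod.fst)).toFinset ⊆ Finset.univ ×ˢ V := by
    intro μ hμ
    simpa using mem_of_mem_ops (List.mem_toFinset.1 hμ)
  have h4 := Finset.card_le_card h3
  rw [List.toFinset_card_of_nodup h2, Finset.card_product] at h4
  simp only [Finset.card_univ, Fintype.card_bool] at h4
  rw [h1]
  omega

theorem Functional.annotator_ne_zero_iff [Finite Alph] (hA : A.Functional) (d : List Alph)
    (t : Tuple V) : A.annotator d t ≠ 0 ↔ ∃ ρ : A.Run d, ρ.tuple = t := by
  have hfin : {ρ : A.Run d | ρ ∈ A.validRuns d ∧ ρ.tuple = t}.Finite :=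
    (finite_valid_runs A d).subset fun ρ _ => hA d ρ
  rw [annotator, finsum_mem_eq_finite_toFinset_sum _ hfin, BoolSR.sum_ne_zero_iff]
  constructor
  · rintro ⟨ρ, h, -⟩
    exact ⟨ρ, ((Set.Finite.mem_toFinset _).1 h).2⟩
  · rintro ⟨ρ, h⟩
    exact ⟨ρ, (Set.Finite.mem_toFinset _).2 ⟨⟨hA d ρ, ρ.weight_ne_zero⟩, h⟩, ρ.weight_ne_zero⟩

/-- Validity and nonzero weight are automatic here, so unambiguity is the injectivity of the tuple
map on runs. -/
theorem Functional.unambiguous_iff [Finite Alph] (hA : A.Functional) :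
    A.Unambiguous ↔ ∀ (d : List Alph) (ρ ρ' : A.Run d), ρ.tuple = ρ'.tuple → ρ = ρ' := by
  constructor
  · intro h d ρ ρ' heq
    exact (h d ρ'.tuple ((hA.annotator_ne_zero_iff _ _).2 ⟨ρ', rfl⟩)).unique
      ⟨⟨hA d ρ, ρ.weight_ne_zero⟩, heq⟩ ⟨⟨hA d ρ', ρ'.weight_ne_zero⟩, rfl⟩
  · intro h d t ht
    obtain ⟨ρ, rfl⟩ := (hA.annotator_ne_zero_iff _ _).1 ht
    exact ⟨ρ, ⟨⟨hA d ρ, ρ.weight_ne_zero⟩, rfl⟩, fun ρ' h' => h d _ _ h'.2⟩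

end Automaton

end VSet

namespace VSet

/-! ### Letter-free blocks -/

namespace Automaton

variable {Alph Var : Type} {V : Finset Var}

/-- The list `s` of labels and target states describes a walk from `p` to `q`. -/
def IsWalk (A : Automaton BoolSR Alph V) : A.Q → List (Label Alph V × A.Q) → A.Q → Prop
  | p, [], q => p = q
  | p, (o, r) :: s, q => A.δ p o r ≠ 0 ∧ A.IsWalk r s q

/-- A walk that reads no letter. -/
def IsBlock (A : Automaton BoolSR Alph V) (p : A.Q) (s : List (Label Alph V × A.Q)) (q : A.Q) :
    Prop := A.IsWalk p s q ∧ letters (s.map Prod.fst) = []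

/-- The state `q` can be reached from `p` without reading a letter. -/
def BlockReach (A : Automaton BoolSR Alph V) (p q : A.Q) : Prop := ∃ s, A.IsBlock p s q

/-- Some walk from `p` to `q` that reads no letter performs the operation `μ`. -/
def BlockOp (A : Automaton BoolSR Alph V) (p q : A.Q) (μ : Bool × Var) : Prop :=
  ∃ s, A.IsBlock p s q ∧ μ ∈ ops (s.map Prod.fst)

/-- The state `p` can be reached from an initial state. -/
def Reachable (A : Automaton BoolSR Alph V) (p : A.Q) : Prop :=
  ∃ q u, A.init q ≠ 0 ∧ A.IsWalk q u p

variable {A : Automaton BoolSR Alph V} {p q r : A.Q} {s s' : List (Label Alph V × A.Q)}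

theorem isPath_append : A.IsPath p (s ++ s') ↔ ∃ q, A.IsWalk p s q ∧ A.IsPath q s' := by
  induction s generalizing p with
  | nil => simp [IsWalk]
  | cons x s ih => simp [IsWalk, IsPath, ih, and_assoc]

theorem isWalk_append : A.IsWalk p (s ++ s') r ↔ ∃ q, A.IsWalk p s q ∧ A.IsWalk q s' r := by
  induction s generalizing p with
  | nil => simp [IsWalk]
  | cons x s ih => simp [IsWalk, ih, and_assoc]

theorem IsWalk.unique (h : A.IsWalk p s q) (h' : A.IsWalk p s r) : q = r := by
  induction s generalizing p with
  | nil => exact Eq.trans (Eq.symm h) h'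
  | cons x s ih => exact ih h.2 h'.2

theorem IsBlock.append (h : A.IsBlock p s q) (h' : A.IsBlock q s' r) : A.IsBlock p (s ++ s') r :=
  ⟨isWalk_append.2 ⟨q, h.1, h'.1⟩, by
    rw [List.map_append, letters, List.filterMap_append, List.append_eq_nil_iff]
    exact ⟨h.2, h'.2⟩⟩

theorem isBlock_singleton {o : Label Alph V} :
    A.IsBlock p [(o, q)] q ↔ A.δ p o q ≠ 0 ∧ o.letter? = none := by
  simp only [IsBlock, IsWalk, and_true]
  cases o <;> simp [Label.letter?]

theorem Reachable.trans (h : A.Reachable p) (h' : A.IsWalk p s q) : A.Reachable q := by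
  obtain ⟨i, u, hi, hu⟩ := h
  exact ⟨i, u ++ s, hi, isWalk_append.2 ⟨p, hu, h'⟩⟩

/-- In a functional automaton, all walks between two given states that lie on runs perform the same
operations. -/
theorem Functional.mem_ops_iff (hA : A.Functional) (hp : A.Reachable p)
    {z : List (Label Alph V × A.Q)} (hq : A.IsPath q z) (hs : A.IsWalk p s q)
    (hs' : A.IsWalk p s' q) {μ : Bool × Var} :
    μ ∈ ops (s.map Prod.fst) ↔ μ ∈ ops (s'.map Prod.fst) := by
  classical
  obtain ⟨i, u, hi, hu⟩ := hp
  -- Completing `s` by the fixed `u` and `z` gives a run, valid by functionality; so the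
  -- multiplicity of `μ` in `s` depends on `u` and `z` only.
  have key : ∀ {s}, A.IsWalk p s q → μ.2 ∈ V → (ops (u.map Prod.fst)).count μ +
      (ops (s.map Prod.fst)).count μ + (ops (z.map Prod.fst)).count μ = 1 := by
    intro s hs hμ
    let ρ : A.Run (letters ((u ++ (s ++ z)).map Prod.fst)) :=
      ⟨i, u ++ (s ++ z), hi, isPath_append.2 ⟨p, hu, isPath_append.2 ⟨q, hs, hq⟩⟩, rfl⟩
    obtain ⟨h1, h2, -⟩ := Run.valid_iff.1 (hA _ ρ) μ.2 hμ
    have h3 : (ops ρ.labels).count μ = 1 := by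
      obtain ⟨c, v⟩ := μ
      cases c
      · exact h1
      · exact h2
    simpa [ρ, Run.labels, ops, List.count_append, add_assoc] using h3
  constructor
  · intro h
    have hμ := mem_of_mem_ops h
    have := key hs hμ
    have := key hs' hμ
    have := List.count_pos_iff.2 h
    exact List.count_pos_iff.1 (by omega)
  · intro h
    have hμ := mem_of_mem_ops h
    have := key hs hμ
    have := key hs' hμ
    have := List.count_pos_iff.2 h
    exact List.count_pos_iff.1 (by omega)

/-- On blocks of runs, the existential `BlockOp` can be read off any single walk. This is why a jump
need only remember end points. -/
theorem Functional.blockOp_iff (hA : A.Functional) (hp : A.Reachable p)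
    {z : List (Label Alph V × A.Q)} (hq : A.IsPath q z) (hs : A.IsBlock p s q) {μ : Bool × Var} :
    A.BlockOp p q μ ↔ μ ∈ ops (s.map Prod.fst) :=
  ⟨fun ⟨_, h, h'⟩ => (hA.mem_ops_iff hp hq h.1 hs.1).1 h', fun h => ⟨s, hs, h⟩⟩

theorem IsPath.exists_block_of_nil (h : A.IsPath p s) (hs : letters (s.map Prod.fst) = []) :
    ∃ q, A.IsBlock p s q ∧ A.fin q ≠ 0 := by
  obtain ⟨q, h1, h2⟩ := isPath_append.1 (show A.IsPath p (s ++ []) by simpa using h)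
  exact ⟨q, ⟨h1, hs⟩, h2⟩

/-- Cuts the path at its first letter; this drives the induction on the document. -/
theorem IsPath.exists_block_of_cons (h : A.IsPath p s) {a : Alph} {d : List Alph}
    (hs : letters (s.map Prod.fst) = a :: d) :
    ∃ b q r s', s = b ++ (.letter a, r) :: s' ∧ A.IsBlock p b q ∧ A.δ q (.letter a) r ≠ 0 ∧
      A.IsPath r s' ∧ letters (s'.map Prod.fst) = d := by
  induction s generalizing p with
  | nil => simp at hs
  | cons x s ih =>
    obtain ⟨o, r⟩ := x
    have step : o.letter? = none → letters (s.map Prod.fst) = a :: d →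
        ∃ b q r' s', (o, r) :: s = b ++ (.letter a, r') :: s' ∧ A.IsBlock p b q ∧
          A.δ q (.letter a) r' ≠ 0 ∧ A.IsPath r' s' ∧ letters (s'.map Prod.fst) = d := by
      intro ho hd
      obtain ⟨b, q, r', s', rfl, h1, h2, h3, h4⟩ := ih h.2 hd
      exact ⟨(o, r) :: b, q, r', s', rfl, (isBlock_singleton.2 ⟨h.1, ho⟩).append h1, h2, h3, h4⟩
    cases o with
    | letter a' =>
      simp only [List.map_cons, letters, List.filterMap_cons, Label.letter?, List.cons.injEq] at hs
      obtain ⟨rfl, hs⟩ := hs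
      exact ⟨[], p, r, s, rfl, ⟨rfl, rfl⟩, h.1, h.2, hs⟩
    | _ => exact step rfl hs

theorem blockReach_iff : A.BlockReach p q ↔
    Relation.ReflTransGen (fun p q => ∃ o, o.letter? = none ∧ A.δ p o q ≠ 0) p q := by
  constructor
  · rintro ⟨s, h⟩
    induction s generalizing p with
    | nil => rw [show p = q from h.1]
    | cons x s ih =>
      obtain ⟨h1, h2⟩ := h
      rw [List.map_cons, ← List.singleton_append, letters, List.filterMap_append,
        List.append_eq_nil_iff] at h2
      refine .head ⟨x.1, ?_, h1.1⟩ (ih ⟨h1.2, h2.2⟩)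
      simpa using h2.1
  · intro h
    induction h with
    | refl => exact ⟨[], rfl, rfl⟩
    | tail _ h ih =>
      obtain ⟨s, hs⟩ := ih
      obtain ⟨o, ho, h⟩ := h
      exact ⟨_, hs.append (isBlock_singleton.2 ⟨h, ho⟩)⟩

/-- Expresses `BlockOp` by reachability and one transition, which is what the algorithm can test. -/
theorem blockOp_iff_exists {μ : Bool × Var} : A.BlockOp p q μ ↔
    ∃ r o r', A.BlockReach p r ∧ A.δ r o r' ≠ 0 ∧ o.op? = some μ ∧ A.BlockReach r' q := by
  constructor
  · rintro ⟨s, h, hμ⟩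
    obtain ⟨o, ho, hoμ⟩ := List.mem_filterMap.1 hμ
    obtain ⟨⟨o, r'⟩, hx, rfl⟩ := List.mem_map.1 ho
    obtain ⟨u, u', rfl⟩ := List.append_of_mem hx
    obtain ⟨h1, h2⟩ := h
    obtain ⟨r, h3, h4⟩ := isWalk_append.1 h1
    simp only [List.map_append, List.map_cons, letters, List.filterMap_append,
      List.append_eq_nil_iff] at h2
    refine ⟨r, o, r', ⟨u, h3, h2.1⟩, h4.1, hoμ, ⟨u', h4.2, ?_⟩⟩
    have h5 := h2.2
    rw [← List.singleton_append, List.filterMap_append, List.append_eq_nil_iff] at h5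
    exact h5.2
  · rintro ⟨r, o, r', ⟨u, h1⟩, h2, h3, ⟨u', h4⟩⟩
    refine ⟨u ++ ([(o, r')] ++ u'), h1.append (.append (isBlock_singleton.2 ⟨h2, ?_⟩) h4), ?_⟩
    · cases o <;> simp [Label.op?, Label.letter?] at h3 ⊢
    · simp [h3]

/-- The first step that reads a letter marks the end of the prefix. -/
theorem split_unique {Q : Type} {b b' s s' : List (Label Alph V × Q)} {a a' : Alph}
    {q q' : Q} (hb : letters (b.map Prod.fst) = []) (hb' : letters (b'.map Prod.fst) = [])
    (h : b ++ (.letter a, q) :: s = b' ++ (.letter a', q') :: s') :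
    b = b' ∧ a = a' ∧ q = q' ∧ s = s' := by
  induction b generalizing b' with
  | nil =>
    cases b' with
    | nil => simp_all
    | cons x b' =>
      simp only [List.nil_append, List.cons_append, List.cons.injEq] at h
      obtain ⟨rfl, -⟩ := h
      simp [Label.letter?] at hb'
  | cons x b ih =>
    cases b' with
    | nil =>
      simp only [List.nil_append, List.cons_append, List.cons.injEq] at h
      obtain ⟨rfl, -⟩ := h
      simp [Label.letter?] at hb
    | cons x' b' =>
      simp only [List.cons_append, List.cons.injEq] at h
      obtain ⟨rfl, h⟩ := h
      have hx : ∀ c : List (Label Alph V × Q), letters ((x :: c).map Prod.fst) = [] →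
          letters (c.map Prod.fst) = [] := fun c hc => by
        rw [List.map_cons, ← List.singleton_append, letters, List.filterMap_append,
          List.append_eq_nil_iff] at hc
        exact hc.2
      simpa using ih (hx _ hb) (hx _ hb') h

end Automaton

/-! ### The join of two automata -/

/-- States of the join automaton: `base p₁ p₂` when a letter has just been read, and
`chain q₁ q₂ l` when the operations `l` are to be performed before the next letter is read in the
states `q₁` and `q₂`. -/
inductive JoinState (Q₁ Q₂ L : Type) : Type
  | base (p₁ : Q₁) (p₂ : Q₂)
  | chain (q₁ : Q₁) (q₂ : Q₂) (l : List L)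

section Join

open Automaton JoinState

variable {Alph Var : Type} [DecidableEq Var] {V₁ V₂ : Finset Var}
  (A₁ : Automaton BoolSR Alph V₁) (A₂ : Automaton BoolSR Alph V₂)

/-- The operations on the variables `vs`, the opening ones first. -/
def allOps (Alph : Type) {V : Finset Var} (vs : List V) : List (Label Alph V) :=
  vs.map .opn ++ vs.map .cls

open Classical in
/-- The operations that one of the automata performs between `pᵢ` and `qᵢ`. -/
noncomputable def jumpOps (vs : List ↥(V₁ ∪ V₂)) (p₁ q₁ : A₁.Q) (p₂ q₂ : A₂.Q) :
    List (Label Alph (V₁ ∪ V₂)) :=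
  (allOps Alph vs).filter fun o =>
    ∃ μ, o.op? = some μ ∧ (A₁.BlockOp p₁ q₁ μ ∨ A₂.BlockOp p₂ q₂ μ)

/-- The automata can simultaneously go from `pᵢ` to `qᵢ` without reading a letter, agreeing on the
operations on their common variables. -/
def Jump (p₁ q₁ : A₁.Q) (p₂ q₂ : A₂.Q) : Prop :=
  A₁.BlockReach p₁ q₁ ∧ A₂.BlockReach p₂ q₂ ∧
    ∀ μ : Bool × Var, μ.2 ∈ V₁ → μ.2 ∈ V₂ → (A₁.BlockOp p₁ q₁ μ ↔ A₂.BlockOp p₂ q₂ μ)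

variable (vs : List ↥(V₁ ∪ V₂))

/-- The transitions of the join automaton. -/
inductive JoinStep : JoinState A₁.Q A₂.Q (Label Alph (V₁ ∪ V₂)) → Label Alph (V₁ ∪ V₂) →
    JoinState A₁.Q A₂.Q (Label Alph (V₁ ∪ V₂)) → Prop
  | jump {p₁ q₁ p₂ q₂} : Jump A₁ A₂ p₁ q₁ p₂ q₂ →
      JoinStep (base p₁ p₂) .eps (chain q₁ q₂ (jumpOps A₁ A₂ vs p₁ q₁ p₂ q₂))
  | op {q₁ q₂ o l} : JoinStep (chain q₁ q₂ (o :: l)) o (chain q₁ q₂ l)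
  | letter {q₁ q₂ a r₁ r₂} : A₁.δ q₁ (.letter a) r₁ ≠ 0 → A₂.δ q₂ (.letter a) r₂ ≠ 0 →
      JoinStep (chain q₁ q₂ []) (.letter a) (base r₁ r₂)

/-- The accepting states of the join automaton. -/
def JoinFin (s : JoinState A₁.Q A₂.Q (Label Alph (V₁ ∪ V₂))) : Prop :=
  ∃ q₁ q₂, s = chain q₁ q₂ [] ∧ A₁.fin q₁ ≠ 0 ∧ A₂.fin q₂ ≠ 0

/-- The initial states of the join automaton. -/
def JoinInit (s : JoinState A₁.Q A₂.Q (Label Alph (V₁ ∪ V₂))) : Prop :=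
  ∃ p₁ p₂, s = base p₁ p₂ ∧ A₁.init p₁ ≠ 0 ∧ A₂.init p₂ ≠ 0

/-- Accepting paths of the join automaton. -/
def JoinPath : JoinState A₁.Q A₂.Q (Label Alph (V₁ ∪ V₂)) →
    List (Label Alph (V₁ ∪ V₂) × JoinState A₁.Q A₂.Q (Label Alph (V₁ ∪ V₂))) → Prop
  | s, [] => JoinFin A₁ A₂ s
  | s, (o, s') :: r => JoinStep A₁ A₂ vs s o s' ∧ JoinPath s' r

/-- The steps that perform the operations `l`. -/
def chainSteps {Q₁ Q₂ L : Type} (q₁ : Q₁) (q₂ : Q₂) : List L → List (L × JoinState Q₁ Q₂ L)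
  | [] => []
  | o :: l => (o, chain q₁ q₂ l) :: chainSteps q₁ q₂ l

/-- The steps from a state `base p₁ p₂` to `chain q₁ q₂ []`. -/
noncomputable def jumpSteps (p₁ q₁ : A₁.Q) (p₂ q₂ : A₂.Q) :
    List (Label Alph (V₁ ∪ V₂) × JoinState A₁.Q A₂.Q (Label Alph (V₁ ∪ V₂))) :=
  (.eps, chain q₁ q₂ (jumpOps A₁ A₂ vs p₁ q₁ p₂ q₂)) ::
    chainSteps q₁ q₂ (jumpOps A₁ A₂ vs p₁ q₁ p₂ q₂)

theorem chainSteps_map_fst {Q₁ Q₂ L : Type} (q₁ : Q₁) (q₂ : Q₂) (l : List L) :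
    (chainSteps q₁ q₂ l).map Prod.fst = l := by
  induction l with
  | nil => rfl
  | cons o l ih => simp [chainSteps, ih]

/-- The path `r` of the join automaton from `base p₁ p₂` is made of the path `s₁` from `p₁` and the
path `s₂` from `p₂`. -/
inductive Proj : A₁.Q → A₂.Q →
    List (Label Alph (V₁ ∪ V₂) × JoinState A₁.Q A₂.Q (Label Alph (V₁ ∪ V₂))) →
    List (Label Alph V₁ × A₁.Q) → List (Label Alph V₂ × A₂.Q) → Prop
  | last {p₁ q₁ p₂ q₂ b₁ b₂} : Jump A₁ A₂ p₁ q₁ p₂ q₂ → A₁.IsBlock p₁ b₁ q₁ →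
      A₂.IsBlock p₂ b₂ q₂ → A₁.fin q₁ ≠ 0 → A₂.fin q₂ ≠ 0 →
      Proj p₁ p₂ (jumpSteps A₁ A₂ vs p₁ q₁ p₂ q₂) b₁ b₂
  | step {p₁ q₁ p₂ q₂ b₁ b₂ a r₁ r₂ r s₁ s₂} : Jump A₁ A₂ p₁ q₁ p₂ q₂ → A₁.IsBlock p₁ b₁ q₁ →
      A₂.IsBlock p₂ b₂ q₂ → A₁.δ q₁ (.letter a) r₁ ≠ 0 → A₂.δ q₂ (.letter a) r₂ ≠ 0 →
      Proj r₁ r₂ r s₁ s₂ →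
      Proj p₁ p₂ (jumpSteps A₁ A₂ vs p₁ q₁ p₂ q₂ ++ (.letter a, base r₁ r₂) :: r)
        (b₁ ++ (.letter a, r₁) :: s₁) (b₂ ++ (.letter a, r₂) :: s₂)

variable {A₁ A₂ vs} {p₁ q₁ : A₁.Q} {p₂ q₂ : A₂.Q}
  {r r' : List (Label Alph (V₁ ∪ V₂) × JoinState A₁.Q A₂.Q (Label Alph (V₁ ∪ V₂)))}
  {s₁ : List (Label Alph V₁ × A₁.Q)} {s₂ : List (Label Alph V₂ × A₂.Q)}

/-- A chain state with pending operations has a single outgoing transition and is not accepting, so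
the path is forced until the list is used up. -/
theorem joinPath_chain {l : List (Label Alph (V₁ ∪ V₂))} :
    JoinPath A₁ A₂ vs (chain q₁ q₂ l) r ↔
      ∃ r', r = chainSteps q₁ q₂ l ++ r' ∧ JoinPath A₁ A₂ vs (chain q₁ q₂ []) r' := by
  induction l generalizing r with
  | nil => simp [chainSteps]
  | cons o l ih =>
    constructor
    · intro h
      cases r with
      | nil => obtain ⟨_, _, h, -⟩ := h; cases h
      | cons x r =>
        obtain ⟨o', s'⟩ := x
        obtain ⟨h1, h2⟩ := h
        cases h1
        obtain ⟨r', rfl, h⟩ := ih.1 h2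
        exact ⟨r', rfl, h⟩
    · rintro ⟨r', rfl, h⟩
      exact ⟨.op, ih.2 ⟨r', rfl, h⟩⟩

theorem joinPath_jumpSteps_append (h : Jump A₁ A₂ p₁ q₁ p₂ q₂)
    (h' : JoinPath A₁ A₂ vs (chain q₁ q₂ []) r) :
    JoinPath A₁ A₂ vs (base p₁ p₂) (jumpSteps A₁ A₂ vs p₁ q₁ p₂ q₂ ++ r) :=
  ⟨.jump h, joinPath_chain.2 ⟨r, rfl, h'⟩⟩

theorem JoinPath.exists_proj (h : JoinPath A₁ A₂ vs (base p₁ p₂) r) :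
    ∃ s₁ s₂, Proj A₁ A₂ vs p₁ p₂ r s₁ s₂ := by
  induction hn : r.length using Nat.strong_induction_on generalizing p₁ p₂ r with
  | _ n ih =>
    cases r with
    | nil => obtain ⟨_, _, h, -⟩ := h; cases h
    | cons x r =>
      obtain ⟨o, s⟩ := x
      obtain ⟨h1, h2⟩ := h
      cases h1 with
      | jump hj =>
        obtain ⟨r', rfl, h3⟩ := joinPath_chain.1 h2
        -- Any walks between the end points of the jump will do.
        obtain ⟨b₁, hb₁⟩ := hj.1
        obtain ⟨b₂, hb₂⟩ := hj.2.1
        cases r' with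
        | nil =>
          obtain ⟨_, _, h, hf₁, hf₂⟩ := h3
          cases h
          refine ⟨b₁, b₂, ?_⟩
          rw [List.append_nil]
          exact .last hj hb₁ hb₂ hf₁ hf₂
        | cons y r' =>
          obtain ⟨o, s⟩ := y
          obtain ⟨h4, h5⟩ := h3
          cases h4 with
          | letter ha₁ ha₂ =>
            obtain ⟨s₁, s₂, hp⟩ := ih r'.length (by simp at hn; omega) h5 rfl
            exact ⟨_, _, .step hj hb₁ hb₂ ha₁ ha₂ hp⟩

theorem Proj.joinPath (h : Proj A₁ A₂ vs p₁ p₂ r s₁ s₂) : JoinPath A₁ A₂ vs (base p₁ p₂) r := by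
  induction h with
  | last hj _ _ hf₁ hf₂ =>
    rw [← List.append_nil (jumpSteps _ _ _ _ _ _ _)]
    exact joinPath_jumpSteps_append hj ⟨_, _, rfl, hf₁, hf₂⟩
  | step hj _ _ ha₁ ha₂ _ ih => exact joinPath_jumpSteps_append hj ⟨.letter ha₁ ha₂, ih⟩

theorem Proj.isPath_left (h : Proj A₁ A₂ vs p₁ p₂ r s₁ s₂) : A₁.IsPath p₁ s₁ := by
  induction h with
  | @last _ _ _ _ b₁ _ _ hb _ hf _ =>
    rw [← List.append_nil b₁]
    exact isPath_append.2 ⟨_, hb.1, hf⟩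
  | step _ hb _ ha _ _ ih => exact isPath_append.2 ⟨_, hb.1, ha, ih⟩

theorem Proj.isPath_right (h : Proj A₁ A₂ vs p₁ p₂ r s₁ s₂) : A₂.IsPath p₂ s₂ := by
  induction h with
  | @last _ _ _ _ _ b₂ _ _ hb _ hf =>
    rw [← List.append_nil b₂]
    exact isPath_append.2 ⟨_, hb.1, hf⟩
  | step _ _ hb _ ha _ ih => exact isPath_append.2 ⟨_, hb.1, ha, ih⟩

/-- The component paths have unique decompositions into blocks and letters. A block determines its
end point, and the steps of a jump are a function of the four end points. -/
theorem Proj.unique (h : Proj A₁ A₂ vs p₁ p₂ r s₁ s₂) (h' : Proj A₁ A₂ vs p₁ p₂ r' s₁ s₂) :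
    r = r' := by
  have no_letter : ∀ {V : Finset Var} {Q : Type} {b s : List (Label Alph V × Q)} {a : Alph} {q : Q},
      letters ((b ++ (.letter a, q) :: s).map Prod.fst) ≠ [] := by
    intro V Q b s a q h
    simp [Label.letter?] at h
  induction h generalizing r' with
  | @last p₁ q₁ p₂ q₂ b₁ b₂ hj hb₁ hb₂ hf₁ hf₂ =>
    -- The indices of `Proj` are concatenations, which case analysis cannot unify; a variable and an
    -- equation take their place.
    generalize ht₁ : b₁ = t₁ at h'
    cases h' with
    | last hj' hb₁' hb₂' hf₁' hf₂' =>
      subst ht₁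
      rw [hb₁.1.unique hb₁'.1, hb₂.1.unique hb₂'.1]
    | step =>
      subst ht₁
      exact absurd hb₁.2 no_letter
  | step hj hb₁ hb₂ ha₁ ha₂ hp ih =>
    generalize ht₁ : (_ ++ _ : List (Label Alph V₁ × A₁.Q)) = t₁ at h'
    generalize ht₂ : (_ ++ _ : List (Label Alph V₂ × A₂.Q)) = t₂ at h'
    cases h' with
    | last hj' hb₁' hb₂' hf₁' hf₂' =>
      rw [← ht₁] at hb₁'
      exact absurd hb₁'.2 no_letter
    | step hj' hb₁' hb₂' ha₁' ha₂' hp' =>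
      obtain ⟨rfl, rfl, rfl, rfl⟩ := split_unique hb₁.2 hb₁'.2 ht₁
      obtain ⟨rfl, -, rfl, rfl⟩ := split_unique hb₂.2 hb₂'.2 ht₂
      rw [hb₁.1.unique hb₁'.1, hb₂.1.unique hb₂'.1, ih hp']

end Join

end VSet

namespace VSet

/-! ### Comparing words block by block -/

section BlockRel

variable {Alph Var : Type} {V X : Finset Var}

/-- The words `b`, performing operations on `V`, and `c`, performing operations on a subset `X` of
`V`, read no letter and perform the same operations on `X`, of which `b` performs the opening ones
first and none twice. -/
structure SameBlock (b : List (Label Alph V)) (c : List (Label Alph X)) : Prop where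
  letters_left : letters b = []
  letters_right : letters c = []
  mem_iff : ∀ μ : Bool × Var, μ.2 ∈ X → (μ ∈ ops b ↔ μ ∈ ops c)
  nodup : (ops b).Nodup
  not_before : ∀ v, ¬ Before (true, v) (false, v) b

/-- Two words are composed of the same letters and, between these, of similar blocks. -/
inductive BlockRel : List (Label Alph V) → List (Label Alph X) → Prop
  | last {b c} : SameBlock b c → BlockRel b c
  | step {b c a w x} : SameBlock b c → BlockRel w x →
      BlockRel (b ++ .letter a :: w) (c ++ .letter a :: x)

variable {b w : List (Label Alph V)} {c x : List (Label Alph X)} {μ : Bool × Var} {n : ℕ}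

theorem BlockRel.letters_eq (h : BlockRel w x) : letters w = letters x := by
  induction h with
  | last h => rw [h.letters_left, h.letters_right]
  | step h _ ih =>
    have h1 := h.letters_left
    have h2 := h.letters_right
    simp only [letters, List.filterMap_append, List.filterMap_cons, Label.letter?] at h1 h2 ih ⊢
    rw [h1, h2, ih]

/-- A position is the number of preceding letters, that is, the index of the block; the order within
a block is invisible. -/
theorem BlockRel.opAt_iff (h : BlockRel w x) (hμ : μ.2 ∈ X) : OpAt μ w n ↔ OpAt μ x n := by
  induction h generalizing n with
  | last h =>
    rw [opAt_of_letters_eq_nil h.letters_left, opAt_of_letters_eq_nil h.letters_right,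
      h.mem_iff μ hμ]
  | step h _ ih =>
    rw [opAt_append h.letters_left, opAt_append h.letters_right, h.mem_iff μ hμ,
      opAt_letter_cons, opAt_letter_cons]
    simp only [ih]

theorem BlockRel.mem_ops_iff (h : BlockRel w x) (hμ : μ.2 ∈ X) : μ ∈ ops w ↔ μ ∈ ops x := by
  simp only [← exists_opAt_iff, h.opAt_iff hμ]

theorem SameBlock.count_le [BEq (Bool × Var)] [LawfulBEq (Bool × Var)] (h : SameBlock b c)
    (hμ : μ.2 ∈ X) : (ops b).count μ ≤ (ops c).count μ := by
  by_cases hb : μ ∈ ops b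
  · have h1 := List.nodup_iff_count_le_one.1 h.nodup μ
    have h2 := List.count_pos_iff.2 ((h.mem_iff μ hμ).1 hb)
    omega
  · rw [List.count_eq_zero_of_not_mem hb]
    omega

theorem BlockRel.count_le [BEq (Bool × Var)] [LawfulBEq (Bool × Var)] (h : BlockRel w x)
    (hμ : μ.2 ∈ X) : (ops w).count μ ≤ (ops x).count μ := by
  induction h with
  | last h => exact h.count_le hμ
  | step h _ ih =>
    have := h.count_le hμ
    simp only [ops, List.filterMap_append, List.filterMap_cons, Label.op?, List.count_append]
      at this ih ⊢
    omega

/-- Within one block of `w` openings come first. So a closing that precedes an opening lies in an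
earlier block, and the same holds in `x`. -/
theorem BlockRel.before (h : BlockRel w x) {v : Var} (hv : v ∈ X)
    (hw : Before (true, v) (false, v) w) : Before (true, v) (false, v) x := by
  induction h with
  | last h => exact absurd hw (h.not_before v)
  | step h h' ih =>
    rw [before_append] at hw ⊢
    rcases hw with hw | ⟨h1, h2⟩ | hw
    · exact absurd hw (h.not_before v)
    · refine .inr (.inl ⟨(h.mem_iff _ hv).1 h1, ?_⟩)
      simp only [ops, List.filterMap_cons, Label.op?] at h2 ⊢
      exact (h'.mem_ops_iff hv).1 h2
    · rw [before_cons] at hw ⊢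
      simp only [Label.op?, reduceCtorEq, false_and, false_or] at hw ⊢
      exact .inr (.inr (ih hw))

theorem ops_allOps (vs : List V) :
    ops (allOps Alph vs) = vs.map (fun v => (false, v.1)) ++ vs.map (fun v => (true, v.1)) := by
  have h1 : ∀ vs : List V,
      ops (vs.map (Label.opn (Alph := Alph))) = vs.map (fun v => (false, v.1)) := by
    intro vs; induction vs <;> simp_all [Label.op?]
  have h2 : ∀ vs : List V,
      ops (vs.map (Label.cls (Alph := Alph))) = vs.map (fun v => (true, v.1)) := by
    intro vs; induction vs <;> simp_all [Label.op?]
  rw [allOps, ops, List.filterMap_append, ← ops, ← ops, h1, h2]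

theorem nodup_ops_allOps {vs : List V} (h : vs.Nodup) :
    (ops (allOps Alph vs)).Nodup := by
  rw [ops_allOps, List.nodup_append]
  refine ⟨h.map fun v v' h => Subtype.ext (congrArg Prod.snd h),
    h.map fun v v' h => Subtype.ext (congrArg Prod.snd h), ?_⟩
  simp

theorem letters_allOps (vs : List V) : letters (allOps Alph vs) = [] := by
  simp [allOps, Label.letter?]

theorem Before.of_sublist {μ ν : Bool × Var}
    (h : b.Sublist w) (hb : Before μ ν b) : Before μ ν w := by
  induction h with
  | slnil => exact hb
  | cons x _ ih => exact before_cons.2 (.inr (ih hb))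
  | cons_cons x h ih =>
    rw [before_cons] at hb ⊢
    exact hb.imp (fun hb => ⟨hb.1, (h.filterMap _).subset hb.2⟩) ih

theorem not_before_allOps (vs : List V) (v : Var) :
    ¬ Before (true, v) (false, v) (allOps Alph vs) := by
  have h1 : ∀ vs : List V, ¬ Before (true, v) (false, v) (vs.map (Label.opn (Alph := Alph))) := by
    rintro vs ⟨u, o, u', h, ho, -⟩
    have : o ∈ vs.map Label.opn := by rw [h]; simp
    obtain ⟨v', -, rfl⟩ := List.mem_map.1 this
    simp [Label.op?] at ho
  have h2 : ∀ vs : List V, (false, v) ∉ ops (vs.map (Label.cls (Alph := Alph))) := by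
    intro vs h
    obtain ⟨o, ho, ho'⟩ := List.mem_filterMap.1 h
    obtain ⟨v', -, rfl⟩ := List.mem_map.1 ho
    simp [Label.op?] at ho'
  rw [allOps, before_append]
  rintro (h | ⟨-, h⟩ | ⟨u, o, u', h, ho, hu'⟩)
  · exact h1 _ h
  · exact h2 _ h
  · refine h2 vs ?_
    rw [h, ops, List.filterMap_append]
    refine List.mem_append_right _ ?_
    rw [← List.singleton_append, List.filterMap_append]
    exact List.mem_append_right _ hu'

/-- Each operation occurs at most as often as in `ρ'`, by `count_le`, and at least once, by
`mem_ops_iff`. -/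
theorem BlockRel.valid [DecidableEq Var] {A : Automaton BoolSR Alph V} {B : Automaton BoolSR Alph X}
    {d : List Alph} {ρ : A.Run d} {ρ' : B.Run d} (h : BlockRel ρ.labels ρ'.labels) (h' : ρ'.Valid)
    {v : Var} (hv : v ∈ X) : (ops ρ.labels).count (false, v) = 1 ∧
      (ops ρ.labels).count (true, v) = 1 ∧ ¬ Before (true, v) (false, v) ρ.labels := by
  have key : ∀ c, (ops ρ'.labels).count (c, v) = 1 → (ops ρ.labels).count (c, v) = 1 := by
    intro c hc
    have h1 := h.count_le (μ := (c, v)) hv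
    have h2 := List.count_pos_iff.2
      ((h.mem_ops_iff (μ := (c, v)) hv).2 (List.count_pos_iff.1 (by omega)))
    omega
  have h3 := Automaton.Run.valid_iff.1 h' v hv
  refine ⟨?_, ?_, fun hb => h3.2.2 (h.before hv hb)⟩
  · convert key false (by convert h3.1)
  · convert key true (by convert h3.2.1)

theorem BlockRel.tuple_eq {A : Automaton BoolSR Alph V}
    {B : Automaton BoolSR Alph X} {d : List Alph} {ρ : A.Run d} {ρ' : B.Run d}
    (h : BlockRel ρ.labels ρ'.labels) (hρ : ρ.Valid) (hρ' : ρ'.Valid) (hX : X ⊆ V) :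
    ρ.tuple.restrict hX = ρ'.tuple :=
  funext fun v => (hρ.tuple_apply_eq_iff hρ' v.1 (hX v.2) v.2).2 fun _ _ => h.opAt_iff v.2

end BlockRel

/-! ### Correctness of the join automaton -/

section Join

open Automaton JoinState

variable {Alph Var : Type} [DecidableEq Var] {V₁ V₂ : Finset Var}
  {A₁ : Automaton BoolSR Alph V₁} {A₂ : Automaton BoolSR Alph V₂} {vs : List ↥(V₁ ∪ V₂)}
  {p₁ q₁ : A₁.Q} {p₂ q₂ : A₂.Q}
  {r r' : List (Label Alph (V₁ ∪ V₂) × JoinState A₁.Q A₂.Q (Label Alph (V₁ ∪ V₂)))}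
  {s₁ : List (Label Alph V₁ × A₁.Q)} {s₂ : List (Label Alph V₂ × A₂.Q)}

theorem mem_jumpOps {o : Label Alph (V₁ ∪ V₂)} : o ∈ jumpOps A₁ A₂ vs p₁ q₁ p₂ q₂ ↔
    o ∈ allOps Alph vs ∧ ∃ μ, o.op? = some μ ∧ (A₁.BlockOp p₁ q₁ μ ∨ A₂.BlockOp p₂ q₂ μ) := by
  classical
  rw [jumpOps, List.mem_filter, decide_eq_true_iff]

theorem mem_ops_jumpOps (hvs : ∀ v, v ∈ vs) {μ : Bool × Var} :
    μ ∈ ops (jumpOps A₁ A₂ vs p₁ q₁ p₂ q₂) ↔ A₁.BlockOp p₁ q₁ μ ∨ A₂.BlockOp p₂ q₂ μ := by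
  constructor
  · intro h
    obtain ⟨o, ho, ho'⟩ := List.mem_filterMap.1 h
    obtain ⟨-, ν, hν, h⟩ := mem_jumpOps.1 ho
    cases ho'.symm.trans hν
    exact h
  · intro h
    have hμ : μ.2 ∈ V₁ ∪ V₂ := by
      rcases h with ⟨s, -, h⟩ | ⟨s, -, h⟩
      · exact Finset.mem_union_left _ (mem_of_mem_ops h)
      · exact Finset.mem_union_right _ (mem_of_mem_ops h)
    have h1 : μ ∈ ops (allOps Alph vs) := by
      rw [ops_allOps]
      obtain ⟨c, v⟩ := μ
      cases c <;> simp [hvs] <;> simpa using hμ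
    obtain ⟨o, ho, ho'⟩ := List.mem_filterMap.1 h1
    exact List.mem_filterMap.2 ⟨o, mem_jumpOps.2 ⟨ho, μ, ho', h⟩, ho'⟩

theorem labels_jumpSteps : (jumpSteps A₁ A₂ vs p₁ q₁ p₂ q₂).map Prod.fst =
    .eps :: jumpOps A₁ A₂ vs p₁ q₁ p₂ q₂ := by
  rw [jumpSteps, List.map_cons, chainSteps_map_fst]

/-- The operations of a jump form a sublist of `allOps`, and absence of letters, of repetitions and
of early closings passes to sublists. -/
theorem sameBlock_jumpSteps {X : Finset Var} {c : List (Label Alph X)} (hnd : vs.Nodup)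
    (hc : letters c = []) (h : ∀ μ : Bool × Var, μ.2 ∈ X →
      (μ ∈ ops (jumpOps A₁ A₂ vs p₁ q₁ p₂ q₂) ↔ μ ∈ ops c)) :
    SameBlock ((jumpSteps A₁ A₂ vs p₁ q₁ p₂ q₂).map Prod.fst) c := by
  rw [labels_jumpSteps]
  have hsub : (jumpOps A₁ A₂ vs p₁ q₁ p₂ q₂).Sublist (allOps Alph vs) := List.filter_sublist
  refine ⟨?_, hc, ?_, ?_, fun v hv => ?_⟩
  · have := hsub.filterMap Label.letter?
    rw [← letters, ← letters, letters_allOps] at this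
    simpa [Label.letter?] using this
  · intro μ hμ
    rw [← h μ hμ]
    simp [Label.op?]
  · exact (nodup_ops_allOps hnd).sublist (hsub.filterMap Label.op?)
  · rw [before_cons] at hv
    simp only [Label.op?, reduceCtorEq, false_and, false_or] at hv
    exact not_before_allOps vs v (hv.of_sublist hsub)

/-- An operation on a variable of one automaton that is contributed by the other concerns a common
variable, on which a jump demands agreement. -/
theorem Jump.mem_ops_iff (h : Jump A₁ A₂ p₁ q₁ p₂ q₂) (hvs : ∀ v, v ∈ vs) {μ : Bool × Var} :
    (μ.2 ∈ V₁ → (μ ∈ ops (jumpOps A₁ A₂ vs p₁ q₁ p₂ q₂) ↔ A₁.BlockOp p₁ q₁ μ)) ∧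
    (μ.2 ∈ V₂ → (μ ∈ ops (jumpOps A₁ A₂ vs p₁ q₁ p₂ q₂) ↔ A₂.BlockOp p₂ q₂ μ)) := by
  have h1 : A₁.BlockOp p₁ q₁ μ → μ.2 ∈ V₁ := fun ⟨_, _, h⟩ => mem_of_mem_ops h
  have h2 : A₂.BlockOp p₂ q₂ μ → μ.2 ∈ V₂ := fun ⟨_, _, h⟩ => mem_of_mem_ops h
  have h3 := h.2.2 μ
  rw [mem_ops_jumpOps hvs]
  tauto

/-- Functionality enters here: each block starts in a reachable state and continues to acceptance,
so whichever walks were chosen perform exactly the operations recorded by the jump. -/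
theorem Proj.blockRel (h : Proj A₁ A₂ vs p₁ p₂ r s₁ s₂) (hnd : vs.Nodup) (hvs : ∀ v, v ∈ vs)
    (hA₁ : A₁.Functional) (hA₂ : A₂.Functional) (hp₁ : A₁.Reachable p₁) (hp₂ : A₂.Reachable p₂) :
    BlockRel (r.map Prod.fst) (s₁.map Prod.fst) ∧ BlockRel (r.map Prod.fst) (s₂.map Prod.fst) := by
  induction h with
  | @last p₁ q₁ p₂ q₂ b₁ b₂ hj hb₁ hb₂ hf₁ hf₂ =>
    have h1 := fun μ => hA₁.blockOp_iff (z := []) (μ := μ) hp₁ hf₁ hb₁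
    have h2 := fun μ => hA₂.blockOp_iff (z := []) (μ := μ) hp₂ hf₂ hb₂
    exact ⟨.last (sameBlock_jumpSteps hnd hb₁.2
        fun μ hμ => ((hj.mem_ops_iff hvs).1 hμ).trans (h1 μ)),
      .last (sameBlock_jumpSteps hnd hb₂.2
        fun μ hμ => ((hj.mem_ops_iff hvs).2 hμ).trans (h2 μ))⟩
  | @step p₁ q₁ p₂ q₂ b₁ b₂ a r₁ r₂ r s₁ s₂ hj hb₁ hb₂ ha₁ ha₂ h ih =>
    have h1 := fun μ => hA₁.blockOp_iff (z := (.letter a, r₁) :: s₁) (μ := μ) hp₁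
      ⟨ha₁, h.isPath_left⟩ hb₁
    have h2 := fun μ => hA₂.blockOp_iff (z := (.letter a, r₂) :: s₂) (μ := μ) hp₂
      ⟨ha₂, h.isPath_right⟩ hb₂
    obtain ⟨h3, h4⟩ := ih
      (hp₁.trans (s := b₁ ++ [(.letter a, r₁)]) (isWalk_append.2 ⟨q₁, hb₁.1, ha₁, rfl⟩))
      (hp₂.trans (s := b₂ ++ [(.letter a, r₂)]) (isWalk_append.2 ⟨q₂, hb₂.1, ha₂, rfl⟩))
    simp only [List.map_append, List.map_cons]
    exact ⟨.step (sameBlock_jumpSteps hnd hb₁.2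
        fun μ hμ => ((hj.mem_ops_iff hvs).1 hμ).trans (h1 μ)) h3,
      .step (sameBlock_jumpSteps hnd hb₂.2
        fun μ hμ => ((hj.mem_ops_iff hvs).2 hμ).trans (h2 μ)) h4⟩

/-- Equal positions of the common operations mean that corresponding blocks perform the same ones,
which by functionality is the condition for a jump between their end points. -/
theorem exists_proj_of_isPath (hA₁ : A₁.Functional) (hA₂ : A₂.Functional)
    (hp₁ : A₁.Reachable p₁) (hp₂ : A₂.Reachable p₂) (h₁ : A₁.IsPath p₁ s₁) (h₂ : A₂.IsPath p₂ s₂)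
    (hl : letters (s₁.map Prod.fst) = letters (s₂.map Prod.fst))
    (hop : ∀ μ : Bool × Var, μ.2 ∈ V₁ → μ.2 ∈ V₂ → ∀ n,
      OpAt μ (s₁.map Prod.fst) n ↔ OpAt μ (s₂.map Prod.fst) n) :
    ∃ r, Proj A₁ A₂ vs p₁ p₂ r s₁ s₂ := by
  generalize hd : letters (s₁.map Prod.fst) = d at hl
  induction d generalizing p₁ p₂ s₁ s₂ with
  | nil =>
    obtain ⟨q₁, hb₁, hf₁⟩ := h₁.exists_block_of_nil hd
    obtain ⟨q₂, hb₂, hf₂⟩ := h₂.exists_block_of_nil hl.symm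
    refine ⟨_, .last ⟨⟨_, hb₁⟩, ⟨_, hb₂⟩, fun μ hμ₁ hμ₂ => ?_⟩ hb₁ hb₂ hf₁ hf₂⟩
    have := hop μ hμ₁ hμ₂ 0
    rw [opAt_of_letters_eq_nil hb₁.2, opAt_of_letters_eq_nil hb₂.2] at this
    rw [hA₁.blockOp_iff (z := []) hp₁ hf₁ hb₁, hA₂.blockOp_iff (z := []) hp₂ hf₂ hb₂]
    simpa using this
  | cons a d ih =>
    obtain ⟨b₁, q₁, r₁, s₁, rfl, hb₁, ha₁, hs₁, hd₁⟩ := h₁.exists_block_of_cons hd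
    obtain ⟨b₂, q₂, r₂, s₂, rfl, hb₂, ha₂, hs₂, hd₂⟩ := h₂.exists_block_of_cons hl.symm
    simp only [List.map_append, List.map_cons, opAt_append hb₁.2, opAt_append hb₂.2,
      opAt_letter_cons] at hop
    obtain ⟨r, hr⟩ := ih
      (hp₁.trans (s := b₁ ++ [(.letter a, r₁)]) (isWalk_append.2 ⟨q₁, hb₁.1, ha₁, rfl⟩))
      (hp₂.trans (s := b₂ ++ [(.letter a, r₂)]) (isWalk_append.2 ⟨q₂, hb₂.1, ha₂, rfl⟩))
      -- Position n after the first letter is position n + 1 overall; position 0 describes the first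
      -- block and is used for the jump below.
      hs₁ hs₂ (fun μ hμ₁ hμ₂ n => by simpa using hop μ hμ₁ hμ₂ (n + 1)) hd₁ hd₂.symm
    refine ⟨_, .step ⟨⟨_, hb₁⟩, ⟨_, hb₂⟩, fun μ hμ₁ hμ₂ => ?_⟩ hb₁ hb₂ ha₁ ha₂ hr⟩
    rw [hA₁.blockOp_iff (z := (.letter a, r₁) :: s₁) hp₁ ⟨ha₁, hs₁⟩ hb₁,
      hA₂.blockOp_iff (z := (.letter a, r₂) :: s₂) hp₂ ⟨ha₂, hs₂⟩ hb₂]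
    simpa using hop μ hμ₁ hμ₂ 0

variable (A₁ A₂ vs)

/-- An ε-step always ends in a chain state, and from a chain state it shortens the pending list. The
latter case must be covered because nothing in the type of states keeps ε out of that list. -/
theorem joinStep_no_eps_cycle (s : JoinState A₁.Q A₂.Q (Label Alph (V₁ ∪ V₂))) :
    ¬ Relation.TransGen (fun s s' => JoinStep A₁ A₂ vs s .eps s') s s := by
  have key : ∀ s s', Relation.TransGen (fun s s' => JoinStep A₁ A₂ vs s .eps s') s s' →
      ∃ q₁ q₂ l, s' = chain q₁ q₂ l ∧ ∀ q₁ q₂ l', s = chain q₁ q₂ l' → l.length < l'.length := by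
    intro s s' h
    induction h with
    | single h =>
      cases h with
      | jump h => exact ⟨_, _, _, rfl, fun _ _ _ h => by cases h⟩
      | op => exact ⟨_, _, _, rfl, fun _ _ _ h => by cases h; simp⟩
    | tail _ h ih =>
      obtain ⟨q₁, q₂, l, rfl, h'⟩ := ih
      cases h with
      | op =>
        refine ⟨_, _, _, rfl, fun _ _ _ h => ?_⟩
        have := h' _ _ _ h
        simp at this
        omega
  intro h
  obtain ⟨q₁, q₂, l, rfl, h'⟩ := key _ _ h
  exact lt_irrefl _ (h' _ _ _ rfl)

open Classical in
/-- The join of two automata, restricted to the states listed in `ss`. -/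
noncomputable def joinAutomaton (ss : List (JoinState A₁.Q A₂.Q (Label Alph (V₁ ∪ V₂)))) :
    Automaton BoolSR Alph (V₁ ∪ V₂) where
  Q := {s // s ∈ ss}
  finite_Q := ss.finite_toSet
  init s := if JoinInit A₁ A₂ s.1 then 1 else 0
  fin s := if JoinFin A₁ A₂ s.1 then 1 else 0
  δ s o s' := if JoinStep A₁ A₂ vs s.1 o s'.1 then 1 else 0
  no_eps_cycle s h := by
    refine joinStep_no_eps_cycle A₁ A₂ vs s.1 (Relation.TransGen.lift Subtype.val ?_ _ _ h)
    intro s s' h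
    by_contra h'
    exact h (if_neg h')

variable {A₁ A₂ vs} {ss : List (JoinState A₁.Q A₂.Q (Label Alph (V₁ ∪ V₂)))}

variable (A₁ A₂ vs ss) in
/-- The state of the join as an element of `JoinState`. -/
def joinVal (s : (joinAutomaton A₁ A₂ vs ss).Q) : JoinState A₁.Q A₂.Q (Label Alph (V₁ ∪ V₂)) :=
  s.1

theorem joinVal_injective : Function.Injective (joinVal A₁ A₂ vs ss) := fun _ _ => Subtype.ext

theorem map_joinVal_map_fst (r : List (Label Alph (V₁ ∪ V₂) × (joinAutomaton A₁ A₂ vs ss).Q)) :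
    (r.map (Prod.map _root_.id (joinVal A₁ A₂ vs ss))).map Prod.fst = r.map Prod.fst := by
  rw [List.map_map]
  rfl

theorem joinAutomaton_init {s} :
    (joinAutomaton A₁ A₂ vs ss).init s ≠ 0 ↔ JoinInit A₁ A₂ (joinVal A₁ A₂ vs ss s) := by
  simp [joinAutomaton, joinVal]

theorem joinAutomaton_fin {s} :
    (joinAutomaton A₁ A₂ vs ss).fin s ≠ 0 ↔ JoinFin A₁ A₂ (joinVal A₁ A₂ vs ss s) := by
  simp [joinAutomaton, joinVal]

theorem joinAutomaton_δ {s o s'} :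
    (joinAutomaton A₁ A₂ vs ss).δ s o s' ≠ 0 ↔
      JoinStep A₁ A₂ vs (joinVal A₁ A₂ vs ss s) o (joinVal A₁ A₂ vs ss s') := by
  simp [joinAutomaton, joinVal]

theorem joinAutomaton_isPath {s : (joinAutomaton A₁ A₂ vs ss).Q}
    {r : List (Label Alph (V₁ ∪ V₂) × (joinAutomaton A₁ A₂ vs ss).Q)} :
    (joinAutomaton A₁ A₂ vs ss).IsPath s r ↔
      JoinPath A₁ A₂ vs (joinVal A₁ A₂ vs ss s)
        (r.map (Prod.map _root_.id (joinVal A₁ A₂ vs ss))) := by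
  induction r generalizing s with
  | nil => exact joinAutomaton_fin
  | cons x r ih => exact and_congr joinAutomaton_δ ih

theorem exists_map_eq_of_joinPath (hss : ∀ s o s', s ∈ ss → JoinStep A₁ A₂ vs s o s' → s' ∈ ss)
    {s} (hs : s ∈ ss) (h : JoinPath A₁ A₂ vs s r) :
    ∃ r' : List (Label Alph (V₁ ∪ V₂) × (joinAutomaton A₁ A₂ vs ss).Q),
      r'.map (Prod.map _root_.id (joinVal A₁ A₂ vs ss)) = r := by
  induction r generalizing s with
  | nil => exact ⟨[], rfl⟩
  | cons x r ih =>
    obtain ⟨o, s'⟩ := x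
    have hs' := hss _ _ _ hs h.1
    obtain ⟨r', rfl⟩ := ih hs' h.2
    exact ⟨(o, ⟨s', hs'⟩) :: r', rfl⟩

/-- A run of the join automaton comes from a pair of runs. -/
theorem joinAutomaton_run (hnd : vs.Nodup) (hvs : ∀ v, v ∈ vs) (hA₁ : A₁.Functional)
    (hA₂ : A₂.Functional) {d : List Alph} (ρ : (joinAutomaton A₁ A₂ vs ss).Run d) :
    ∃ (ρ₁ : A₁.Run d) (ρ₂ : A₂.Run d), joinVal A₁ A₂ vs ss ρ.start = base ρ₁.start ρ₂.start ∧
      Proj A₁ A₂ vs ρ₁.start ρ₂.start (ρ.steps.map (Prod.map _root_.id (joinVal A₁ A₂ vs ss)))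
        ρ₁.steps ρ₂.steps ∧ BlockRel ρ.labels ρ₁.labels ∧ BlockRel ρ.labels ρ₂.labels := by
  obtain ⟨p₁, p₂, hs, hi₁, hi₂⟩ := joinAutomaton_init.1 ρ.init_ne
  have hpath := joinAutomaton_isPath.1 ρ.isPath
  rw [hs] at hpath
  obtain ⟨s₁, s₂, hp⟩ := hpath.exists_proj
  obtain ⟨h₁, h₂⟩ := hp.blockRel hnd hvs hA₁ hA₂ ⟨p₁, [], hi₁, rfl⟩ ⟨p₂, [], hi₂, rfl⟩
  have hl : (ρ.steps.map (Prod.map _root_.id (joinVal A₁ A₂ vs ss))).map Prod.fst = ρ.labels := by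
    rw [map_joinVal_map_fst, Run.labels]
  rw [hl] at h₁ h₂
  exact ⟨⟨p₁, s₁, hi₁, hp.isPath_left, h₁.letters_eq.symm.trans ρ.reads⟩,
    ⟨p₂, s₂, hi₂, hp.isPath_right, h₂.letters_eq.symm.trans ρ.reads⟩, hs, hp, h₁, h₂⟩

/-- Runs with compatible tuples can be combined. -/
theorem exists_joinAutomaton_run (hss : ∀ s o s', s ∈ ss → JoinStep A₁ A₂ vs s o s' → s' ∈ ss)
    (hb : ∀ p₁ p₂, base p₁ p₂ ∈ ss) (hnd : vs.Nodup) (hvs : ∀ v, v ∈ vs)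
    (hA₁ : A₁.Functional) (hA₂ : A₂.Functional) {d : List Alph} (ρ₁ : A₁.Run d) (ρ₂ : A₂.Run d)
    (h : ∀ v (h₁ : v ∈ V₁) (h₂ : v ∈ V₂), ρ₁.tuple ⟨v, h₁⟩ = ρ₂.tuple ⟨v, h₂⟩) :
    ∃ ρ : (joinAutomaton A₁ A₂ vs ss).Run d,
      BlockRel ρ.labels ρ₁.labels ∧ BlockRel ρ.labels ρ₂.labels := by
  have hp₁ : A₁.Reachable ρ₁.start := ⟨_, [], ρ₁.init_ne, rfl⟩
  have hp₂ : A₂.Reachable ρ₂.start := ⟨_, [], ρ₂.init_ne, rfl⟩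
  obtain ⟨r, hr⟩ := exists_proj_of_isPath (vs := vs) hA₁ hA₂ hp₁ hp₂ ρ₁.isPath ρ₂.isPath
    (ρ₁.reads.trans ρ₂.reads.symm) (fun μ hμ₁ hμ₂ n =>
      ((hA₁ d ρ₁).tuple_apply_eq_iff (hA₂ d ρ₂) μ.2 hμ₁ hμ₂).1 (h μ.2 hμ₁ hμ₂) μ.1 n)
  have hbr := hr.blockRel hnd hvs hA₁ hA₂ hp₁ hp₂
  obtain ⟨r, rfl⟩ := exists_map_eq_of_joinPath hss (hb _ _) hr.joinPath
  rw [map_joinVal_map_fst] at hbr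
  exact ⟨⟨⟨_, hb ρ₁.start ρ₂.start⟩, r, joinAutomaton_init.2 ⟨_, _, rfl, ρ₁.init_ne, ρ₂.init_ne⟩,
    joinAutomaton_isPath.2 hr.joinPath, hbr.1.letters_eq.trans ρ₁.reads⟩, hbr⟩

theorem joinAutomaton_functional (hnd : vs.Nodup) (hvs : ∀ v, v ∈ vs) (hA₁ : A₁.Functional)
    (hA₂ : A₂.Functional) : (joinAutomaton A₁ A₂ vs ss).Functional := by
  intro d ρ
  obtain ⟨ρ₁, ρ₂, -, -, h₁, h₂⟩ := joinAutomaton_run hnd hvs hA₁ hA₂ ρ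
  refine Run.valid_iff.2 fun v hv => ?_
  rcases Finset.mem_union.1 hv with hv | hv
  · convert h₁.valid (hA₁ d ρ₁) hv
  · convert h₂.valid (hA₂ d ρ₂) hv

/-- Runs with the same tuple project to runs with the same restricted tuples, hence to the same pair
of runs; the pair determines the run of the join by `Proj.unique`. -/
theorem joinAutomaton_unambiguous [Finite Alph] (hnd : vs.Nodup) (hvs : ∀ v, v ∈ vs)
    (hA₁ : A₁.Functional) (hA₂ : A₂.Functional) (hu₁ : A₁.Unambiguous) (hu₂ : A₂.Unambiguous) :
    (joinAutomaton A₁ A₂ vs ss).Unambiguous := by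
  have hf := joinAutomaton_functional (ss := ss) hnd hvs hA₁ hA₂
  rw [hf.unambiguous_iff]
  rw [hA₁.unambiguous_iff] at hu₁
  rw [hA₂.unambiguous_iff] at hu₂
  intro d ρ ρ' heq
  obtain ⟨ρ₁, ρ₂, hs, hp, h₁, h₂⟩ := joinAutomaton_run hnd hvs hA₁ hA₂ ρ
  obtain ⟨ρ₁', ρ₂', hs', hp', h₁', h₂'⟩ := joinAutomaton_run hnd hvs hA₁ hA₂ ρ'
  have e₁ := h₁.tuple_eq (hf d ρ) (hA₁ d ρ₁) Finset.subset_union_left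
  have e₁' := h₁'.tuple_eq (hf d ρ') (hA₁ d ρ₁') Finset.subset_union_left
  have e₂ := h₂.tuple_eq (hf d ρ) (hA₂ d ρ₂) Finset.subset_union_right
  have e₂' := h₂'.tuple_eq (hf d ρ') (hA₂ d ρ₂') Finset.subset_union_right
  rw [heq] at e₁ e₂
  obtain rfl := hu₁ d _ _ (e₁.symm.trans e₁')
  obtain rfl := hu₂ d _ _ (e₂.symm.trans e₂')
  refine Run.ext (joinVal_injective (hs.trans hs'.symm)) ?_
  exact List.map_injective_iff.2 (Function.injective_id.prodMap joinVal_injective)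
    (hp.unique hp')

/-- Runs of the join project to component runs with the restricted tuples. Conversely, component
runs whose tuples restrict a single `t` agree on common variables and can be combined. -/
theorem joinAutomaton_annotator [Finite Alph]
    (hss : ∀ s o s', s ∈ ss → JoinStep A₁ A₂ vs s o s' → s' ∈ ss)
    (hb : ∀ p₁ p₂, base p₁ p₂ ∈ ss) (hnd : vs.Nodup) (hvs : ∀ v, v ∈ vs)
    (hA₁ : A₁.Functional) (hA₂ : A₂.Functional) :
    (joinAutomaton A₁ A₂ vs ss).annotator = Annotator.join A₁.annotator A₂.annotator := by
  have hf := joinAutomaton_functional (ss := ss) hnd hvs hA₁ hA₂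
  funext d t
  refine BoolSR.eq_of_ne_zero_iff ?_
  rw [hf.annotator_ne_zero_iff, Annotator.join, mul_ne_zero_iff, hA₁.annotator_ne_zero_iff,
    hA₂.annotator_ne_zero_iff]
  constructor
  · rintro ⟨ρ, rfl⟩
    obtain ⟨ρ₁, ρ₂, -, -, h₁, h₂⟩ := joinAutomaton_run hnd hvs hA₁ hA₂ ρ
    exact ⟨⟨ρ₁, (h₁.tuple_eq (hf d ρ) (hA₁ d ρ₁) _).symm⟩,
      ⟨ρ₂, (h₂.tuple_eq (hf d ρ) (hA₂ d ρ₂) _).symm⟩⟩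
  · rintro ⟨⟨ρ₁, e₁⟩, ⟨ρ₂, e₂⟩⟩
    obtain ⟨ρ, h₁, h₂⟩ := exists_joinAutomaton_run hss hb hnd hvs hA₁ hA₂ ρ₁ ρ₂ (by
      intro v hv₁ hv₂
      rw [e₁, e₂]
      rfl)
    have e₁' := h₁.tuple_eq (hf d ρ) (hA₁ d ρ₁) Finset.subset_union_left
    have e₂' := h₂.tuple_eq (hf d ρ) (hA₂ d ρ₂) Finset.subset_union_right
    refine ⟨ρ, funext fun ⟨v, hv⟩ => ?_⟩
    rcases Finset.mem_union.1 hv with hv | hv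
    · exact congrFun (e₁'.trans e₁) ⟨v, hv⟩
    · exact congrFun (e₂'.trans e₂) ⟨v, hv⟩

end Join

end VSet

namespace VSet

namespace Data

/-! ### The algorithm -/

/-- The letters of an encoded automaton. -/
def lettersOf (x : Data) : List Data := x.hd.toList

/-- The variables of an encoded automaton. -/
def varsOf (x : Data) : List Data := x.tl.hd.toList

/-- The states of an encoded automaton. -/
def statesOf (x : Data) : List Data := x.tl.tl.hd.toList

/-- The initial states of an encoded automaton. -/
def initsOf (x : Data) : List Data := x.tl.tl.tl.hd.toList

/-- The accepting states of an encoded automaton. -/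
def finsOf (x : Data) : List Data := x.tl.tl.tl.tl.hd.toList

/-- The transitions of an encoded automaton. -/
def transOf (x : Data) : List Data := x.tl.tl.tl.tl.tl.hd.toList

/-- The source of an encoded transition. -/
def src (t : Data) : Data := t.hd

/-- The label of an encoded transition. -/
def lab (t : Data) : Data := t.tl.hd

/-- The target of an encoded transition. -/
def tgt (t : Data) : Data := t.tl.tl

/-- Whether an encoded transition reads a letter. -/
def readsLetter (t : Data) : Bool := decide (t.lab.hd = ofNat 1)

/-- One step of the computation of a transitive closure: the pairs of elements of `qs` that are
related by `R` or connected through `R` and the edge `t`. -/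
def closureStep (qs : List Data) (t : Data) (R : List Data) : List Data :=
  (pairs qs qs).filter fun z =>
    decide (z ∈ R) || (decide (cons z.hd t.src ∈ R) && decide (cons t.tgt z.tl ∈ R))

/-- The reflexive and transitive closure of the graph with vertices `qs` and edges `es`. -/
def closure (qs es : List Data) : List Data :=
  es.foldl (fun R t => closureStep qs t R) ((pairs qs qs).filter fun z => decide (z.hd = z.tl))

/-- The pairs of states connected by transitions that read no letter. -/
def reach (x : Data) : List Data :=
  closure x.statesOf (x.transOf.filter fun t => !t.readsLetter)

/-- The labels of the transitions that read no letter and lie between `p` and `q`. -/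
def blockOps (x p q : Data) : List Data :=
  (x.transOf.filter fun t => !t.readsLetter &&
    (decide (cons p t.src ∈ x.reach) && decide (cons t.tgt q ∈ x.reach))).map fun t => t.lab

/-- The variables of two automata, without repetitions. -/
def joinVars (x₁ x₂ : Data) : List Data := dedup (x₁.varsOf ++ x₂.varsOf)

/-- The operations on the variables of two automata. -/
def joinOps (x₁ x₂ : Data) : List Data :=
  (joinVars x₁ x₂).map (fun v => cons (ofNat 2) v) ++ (joinVars x₁ x₂).map fun v => cons (ofNat 3) v

/-- The operations performed by the jump `j`. -/
def opsOfJump (x₁ x₂ j : Data) : List Data :=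
  (joinOps x₁ x₂).filter fun o =>
    decide (o ∈ blockOps x₁ j.hd.hd j.hd.tl) || decide (o ∈ blockOps x₂ j.tl.hd j.tl.tl)

/-- The jumps of the join automaton. -/
def jumps (x₁ x₂ : Data) : List Data :=
  (pairs x₁.reach x₂.reach).filter fun j => (joinOps x₁ x₂).all fun o =>
    !(decide (o.tl ∈ x₁.varsOf) && decide (o.tl ∈ x₂.varsOf)) ||
      (decide (o ∈ blockOps x₁ j.hd.hd j.hd.tl) == decide (o ∈ blockOps x₂ j.tl.hd j.tl.tl))

/-- The source of a jump. -/
def jumpSrc (j : Data) : Data := cons nil (cons j.hd.hd j.tl.hd)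

/-- The state reached by a jump after which the operations `l` are still to be performed. -/
def jumpTgt (j l : Data) : Data := cons (cons nil l) (cons j.hd.tl j.tl.tl)

/-- The states of the join automaton. -/
def joinStates (x₁ x₂ : Data) : List Data :=
  (pairs x₁.statesOf x₂.statesOf).map (fun z => cons nil z) ++
    ((pairs x₁.statesOf x₂.statesOf).map (fun z => cons (cons nil nil) z) ++
      (jumps x₁ x₂).flatMap fun j => (suffixes (opsOfJump x₁ x₂ j)).map fun l => jumpTgt j l)

/-- The initial states of the join automaton. -/
def joinInits (x₁ x₂ : Data) : List Data :=
  (pairs x₁.initsOf x₂.initsOf).map fun z => cons nil z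

/-- The accepting states of the join automaton. -/
def joinFins (x₁ x₂ : Data) : List Data :=
  (pairs x₁.finsOf x₂.finsOf).map fun z => cons (cons nil nil) z

/-- The transitions of the join automaton that start a jump. -/
def jumpTrans (x₁ x₂ : Data) : List Data :=
  (jumps x₁ x₂).map fun j =>
    cons (jumpSrc j) (cons (cons nil nil) (jumpTgt j (ofList (opsOfJump x₁ x₂ j))))

/-- The transitions of the join automaton that perform an operation. -/
def opTrans (x₁ x₂ : Data) : List Data :=
  (jumps x₁ x₂).flatMap fun j =>
    ((suffixes (opsOfJump x₁ x₂ j)).filter fun l => !decide (l = nil)).map fun l =>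
      cons (jumpTgt j l) (cons l.hd (jumpTgt j l.tl))

/-- The transitions of the join automaton that read a letter. -/
def letterTrans (x₁ x₂ : Data) : List Data :=
  ((pairs x₁.transOf x₂.transOf).filter fun z =>
    z.hd.readsLetter && decide (z.hd.lab = z.tl.lab)).map fun z =>
      cons (cons (cons nil nil) (cons z.hd.src z.tl.src))
        (cons z.hd.lab (cons nil (cons z.hd.tgt z.tl.tgt)))

/-- The encoding of the join automaton. -/
def joinData (x₁ x₂ : Data) : Data :=
  ofList [ofList x₁.lettersOf, ofList (x₁.varsOf ++ x₂.varsOf), ofList (joinStates x₁ x₂),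
    ofList (joinInits x₁ x₂), ofList (joinFins x₁ x₂),
    ofList (jumpTrans x₁ x₂ ++ (opTrans x₁ x₂ ++ letterTrans x₁ x₂))]

end Data

open Data

/-! ### Cost of the algorithm -/

section Cost

variable {x x₁ x₂ p q : Data → Data}

theorem polyTime_statesOf (hx : PolyTime x) : PolyTimeList fun e => (x e).statesOf :=
  .toList hx.tl.tl.hd

theorem polyTime_varsOf (hx : PolyTime x) : PolyTimeList fun e => (x e).varsOf :=
  .toList hx.tl.hd

theorem polyTime_transOf (hx : PolyTime x) : PolyTimeList fun e => (x e).transOf :=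
  .toList hx.tl.tl.tl.tl.tl.hd

theorem polyTime_src (hx : PolyTime x) : PolyTime fun e => (x e).src := hx.hd

theorem polyTime_lab (hx : PolyTime x) : PolyTime fun e => (x e).lab := hx.tl.hd

theorem polyTime_tgt (hx : PolyTime x) : PolyTime fun e => (x e).tgt := hx.tl.tl

theorem polyTime_readsLetter (hx : PolyTime x) : PolyTimeBool fun e => (x e).readsLetter :=
  .eq (polyTime_lab hx).hd (.const _)

/-- Every intermediate relation is a sublist of the list of all pairs, so the accumulator stays
bounded however many edges are processed. -/
theorem polyTime_closure {qs es : Data → List Data} (hqs : PolyTimeList qs)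
    (hes : PolyTimeList es) : PolyTimeList fun e => closure (qs e) (es e) := by
  have hpairs := hqs.pairs hqs
  obtain ⟨S, hS⟩ := hpairs.size_le
  have hstep : PolyTimeList fun z => closureStep (qs z.tl.tl) z.hd z.tl.hd.toList := by
    have hR : PolyTimeList fun z : Data => z.tl.tl.hd.toList := .toList PolyTime.id.tl.tl.hd
    exact .filter (hpairs.comp PolyTime.id.tl.tl) (.or (.mem PolyTime.id.hd hR)
      (.and (.mem (PolyTime.id.hd.hd.cons (polyTime_src PolyTime.id.tl.hd)) hR)
        (.mem ((polyTime_tgt PolyTime.id.tl.hd).cons PolyTime.id.hd.tl) hR)))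
  have h := PolyTime.foldl (step := fun t acc e => ofList (closureStep (qs e) t acc.toList)) hes
    (hpairs.filter (g := fun z _ => decide (z.hd = z.tl))
      (.eq PolyTime.id.hd.hd PolyTime.id.hd.tl)) hstep
    (fun e _ acc => acc.size ≤ (ofList (pairs (qs e) (qs e))).size) S
    (fun e => size_ofList_le_of_sublist List.filter_sublist)
    (fun e a r acc _ _ => size_ofList_le_of_sublist List.filter_sublist)
    (fun e r acc h => h.trans (hS e))
  refine h.of_eq fun e => ?_
  have key : ∀ l R : List Data, ofList (l.foldl (fun R t => closureStep (qs e) t R) R) =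
      l.foldl (fun acc t => ofList (closureStep (qs e) t acc.toList)) (ofList R) := by
    intro l
    induction l with
    | nil => simp
    | cons t l ih => intro R; rw [List.foldl_cons, ih, List.foldl_cons, toList_ofList]
  exact key _ _

theorem polyTime_reach (hx : PolyTime x) : PolyTimeList fun e => (x e).reach :=
  polyTime_closure (polyTime_statesOf hx)
    (.filter (polyTime_transOf hx) (polyTime_readsLetter PolyTime.id.hd).not)

theorem polyTime_blockOps (hx : PolyTime x) (hp : PolyTime p) (hq : PolyTime q) :
    PolyTimeList fun e => blockOps (x e) (p e) (q e) := by
  have hR : PolyTimeList fun z : Data => (x z.tl).reach := polyTime_reach (hx.comp PolyTime.id.tl)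
  exact .map (.filter (polyTime_transOf hx) (.and (polyTime_readsLetter PolyTime.id.hd).not
    (.and (.mem ((hp.comp PolyTime.id.tl).cons (polyTime_src PolyTime.id.hd)) hR)
      (.mem ((polyTime_tgt PolyTime.id.hd).cons (hq.comp PolyTime.id.tl)) hR))))
    (polyTime_lab PolyTime.id.hd)

theorem polyTime_joinOps (h₁ : PolyTime x₁) (h₂ : PolyTime x₂) :
    PolyTimeList fun e => joinOps (x₁ e) (x₂ e) := by
  have hv : PolyTimeList fun e => joinVars (x₁ e) (x₂ e) :=
    .dedup (.append (polyTime_varsOf h₁) (polyTime_varsOf h₂))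
  exact .append (.map hv (PolyTime.cons (.const _) PolyTime.id.hd))
    (.map hv (PolyTime.cons (.const _) PolyTime.id.hd))

theorem polyTime_opsOfJump {j : Data → Data} (h₁ : PolyTime x₁) (h₂ : PolyTime x₂)
    (hj : PolyTime j) : PolyTimeList fun e => opsOfJump (x₁ e) (x₂ e) (j e) := by
  have hj' : PolyTime fun z : Data => j z.tl := hj.comp PolyTime.id.tl
  exact .filter (polyTime_joinOps h₁ h₂)
    (.or (.mem PolyTime.id.hd (polyTime_blockOps (h₁.comp PolyTime.id.tl) hj'.hd.hd hj'.hd.tl))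
      (.mem PolyTime.id.hd (polyTime_blockOps (h₂.comp PolyTime.id.tl) hj'.tl.hd hj'.tl.tl)))

theorem polyTime_jumps (h₁ : PolyTime x₁) (h₂ : PolyTime x₂) :
    PolyTimeList fun e => jumps (x₁ e) (x₂ e) := by
  have h₁' : PolyTime fun z : Data => x₁ z.tl := h₁.comp PolyTime.id.tl
  have h₂' : PolyTime fun z : Data => x₂ z.tl := h₂.comp PolyTime.id.tl
  -- Each bound variable is paired in front of its environment: inside the two nested loops the
  -- argument is the operation, then the jump, then the original input.
  have h₁'' : PolyTime fun z : Data => x₁ z.tl.tl := h₁.comp PolyTime.id.tl.tl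
  have h₂'' : PolyTime fun z : Data => x₂ z.tl.tl := h₂.comp PolyTime.id.tl.tl
  have hj : PolyTime fun z : Data => z.tl.hd := PolyTime.id.tl.hd
  exact .filter (.pairs (polyTime_reach h₁) (polyTime_reach h₂))
    (.all (polyTime_joinOps h₁' h₂') (.or (.not (.and
      (.mem PolyTime.id.hd.tl (polyTime_varsOf h₁''))
      (.mem PolyTime.id.hd.tl (polyTime_varsOf h₂''))))
      (.beq (.mem PolyTime.id.hd (polyTime_blockOps h₁'' hj.hd.hd hj.hd.tl))
        (.mem PolyTime.id.hd (polyTime_blockOps h₂'' hj.tl.hd hj.tl.tl)))))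

theorem polyTime_jumpTgt {j l : Data → Data} (hj : PolyTime j) (hl : PolyTime l) :
    PolyTime fun e => jumpTgt (j e) (l e) :=
  (PolyTime.nil.cons hl).cons (hj.hd.tl.cons hj.tl.tl)

theorem polyTime_joinData : PolyTime fun e => joinData e.hd e.tl := by
  have h₁ : PolyTime fun e : Data => e.hd := PolyTime.id.hd
  have h₂ : PolyTime fun e : Data => e.tl := PolyTime.id.tl
  have hops : PolyTimeList fun z : Data => opsOfJump z.tl.hd z.tl.tl z.hd :=
    polyTime_opsOfJump PolyTime.id.tl.hd PolyTime.id.tl.tl PolyTime.id.hd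
  have hpairs := PolyTimeList.pairs (polyTime_statesOf h₁) (polyTime_statesOf h₂)
  have hstates : PolyTimeList fun e => joinStates e.hd e.tl :=
    .append (.map hpairs (PolyTime.nil.cons PolyTime.id.hd))
      (.append (.map hpairs (.cons (.const _) PolyTime.id.hd))
        (.flatMap (polyTime_jumps h₁ h₂) (.map (.suffixes hops)
          (polyTime_jumpTgt PolyTime.id.tl.hd PolyTime.id.hd))))
  have hinits : PolyTimeList fun e => joinInits e.hd e.tl :=
    .map (.pairs (.toList h₁.tl.tl.tl.hd) (.toList h₂.tl.tl.tl.hd))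
      (PolyTime.nil.cons PolyTime.id.hd)
  have hfins : PolyTimeList fun e => joinFins e.hd e.tl :=
    .map (.pairs (.toList h₁.tl.tl.tl.tl.hd) (.toList h₂.tl.tl.tl.tl.hd))
      (.cons (.const _) PolyTime.id.hd)
  have hjt : PolyTimeList fun e => jumpTrans e.hd e.tl :=
    .map (polyTime_jumps h₁ h₂) (.cons (PolyTime.nil.cons
      (PolyTime.id.hd.hd.hd.cons PolyTime.id.hd.tl.hd))
      (.cons (.const _) (polyTime_jumpTgt PolyTime.id.hd hops)))
  have hot : PolyTimeList fun e => opTrans e.hd e.tl :=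
    .flatMap (polyTime_jumps h₁ h₂) (.map
      (.filter (.suffixes hops) (.not (.eq PolyTime.id.hd .nil)))
      (.cons (polyTime_jumpTgt PolyTime.id.tl.hd PolyTime.id.hd)
        (.cons PolyTime.id.hd.hd (polyTime_jumpTgt PolyTime.id.tl.hd PolyTime.id.hd.tl))))
  have hlt : PolyTimeList fun e => letterTrans e.hd e.tl :=
    .map (.filter (.pairs (polyTime_transOf h₁) (polyTime_transOf h₂))
      (.and (polyTime_readsLetter PolyTime.id.hd.hd)
        (.eq (polyTime_lab PolyTime.id.hd.hd) (polyTime_lab PolyTime.id.hd.tl))))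
      (.cons (.cons (.const _) (.cons (polyTime_src PolyTime.id.hd.hd)
        (polyTime_src PolyTime.id.hd.tl)))
        (.cons (polyTime_lab PolyTime.id.hd.hd) (PolyTime.nil.cons
          (.cons (polyTime_tgt PolyTime.id.hd.hd) (polyTime_tgt PolyTime.id.hd.tl)))))
  exact .cons (PolyTimeList.toList h₁.hd)
    (.cons (PolyTimeList.append (polyTime_varsOf h₁) (polyTime_varsOf h₂))
      (.cons hstates (.cons hinits (.cons hfins
        (.cons (PolyTimeList.append hjt (.append hot hlt)) .nil)))))

end Cost

end VSet

/-! ### Typed lists, transitive closure and other list computations -/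

namespace VSet

/-- Turns a list of names computed by the algorithm into the list of named objects that `Encodes`
and the construction ask for. -/
theorem exists_list_of_mem_iff {α β : Type*} {f : α → β} (hf : Function.Injective f) {P : α → Prop}
    {l : List β} (h : ∀ b, b ∈ l ↔ ∃ a, P a ∧ f a = b) :
    ∃ l' : List α, l = l'.map f ∧ ∀ a, a ∈ l' ↔ P a := by
  have hl : l ∈ Set.range (List.map f) := by
    rw [Set.range_list_map]
    intro b hb
    obtain ⟨a, -, ha⟩ := (h b).1 hb
    exact ⟨a, ha⟩
  obtain ⟨l', rfl⟩ := hl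
  refine ⟨l', rfl, fun a => ?_⟩
  rw [← List.mem_map_of_injective hf, h]
  exact ⟨fun ⟨a', h', e⟩ => hf e ▸ h', fun h' => ⟨a, h', rfl⟩⟩

/-- A path that uses the new edge can be cut at its first and at its last use, and what lies between
is dropped; so the edge is needed at most once. -/
theorem reflTransGen_or_edge {α : Type*} {E : α → α → Prop} {s t p q : α} :
    Relation.ReflTransGen (fun a b => E a b ∨ (s = a ∧ t = b)) p q ↔
      Relation.ReflTransGen E p q ∨
        (Relation.ReflTransGen E p s ∧ Relation.ReflTransGen E t q) := by
  constructor
  · intro h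
    induction h with
    | refl => exact .inl .refl
    | tail _ h ih =>
      rcases h with h | ⟨rfl, rfl⟩
      · exact ih.imp (·.tail h) fun h' => ⟨h'.1, h'.2.tail h⟩
      · exact .inr ⟨ih.elim _root_.id And.left, .refl⟩
  · have hmono : ∀ {a b}, Relation.ReflTransGen E a b →
        Relation.ReflTransGen (fun a b => E a b ∨ (s = a ∧ t = b)) a b :=
      Relation.ReflTransGen.mono (fun _ _ h => Or.inl h) _ _
    rintro (h | ⟨h, h'⟩)
    · exact hmono h
    · exact (hmono h).trans (.head (.inr ⟨rfl, rfl⟩) (hmono h'))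

namespace Data

theorem mem_pairs {l m : List Data} {z : Data} :
    z ∈ pairs l m ↔ ∃ a ∈ l, ∃ b ∈ m, cons a b = z := by
  simp [pairs]

theorem mem_suffixes {l : List Data} {z : Data} : z ∈ suffixes l ↔ ∃ m, m <:+ l ∧ ofList m = z := by
  simp [suffixes]

theorem dedup_spec (l : List Data) : (dedup l).Nodup ∧ ∀ a, a ∈ dedup l ↔ a ∈ l := by
  have key : ∀ s t : List Data, t.Nodup →
      (s.foldl (fun acc a => if a ∈ acc then acc else a :: acc) t).Nodup ∧
      ∀ a, a ∈ s.foldl (fun acc a => if a ∈ acc then acc else a :: acc) t ↔ a ∈ s ∨ a ∈ t := by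
    intro s
    induction s with
    | nil => simp
    | cons b s ih =>
      intro t ht
      rw [List.foldl_cons]
      by_cases hb : b ∈ t
      · rw [if_pos hb]
        refine ⟨(ih t ht).1, fun a => ?_⟩
        rw [(ih t ht).2, List.mem_cons]
        constructor
        · tauto
        · rintro ((rfl | h) | h) <;> tauto
      · rw [if_neg hb]
        have ih := ih (b :: t) (List.nodup_cons.2 ⟨hb, ht⟩)
        refine ⟨ih.1, fun a => ?_⟩
        rw [ih.2, List.mem_cons, List.mem_cons]
        tauto
  simpa [dedup] using key l [] List.nodup_nil

/-- By induction on the edges, the last one being inserted by `closureStep`. End points of edges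
must belong to `qs`, since the relation is only tabulated there. -/
theorem mem_closure {qs es : List Data} (hes : ∀ t ∈ es, t.src ∈ qs ∧ t.tgt ∈ qs) {z : Data} :
    z ∈ closure qs es ↔ ∃ a ∈ qs, ∃ b ∈ qs,
      Relation.ReflTransGen (fun a b => ∃ t ∈ es, t.src = a ∧ t.tgt = b) a b ∧ cons a b = z := by
  induction es using List.reverseRecOn generalizing z with
  | nil =>
    have hnil : ∀ a b : Data, Relation.ReflTransGen
        (fun a b => ∃ t ∈ ([] : List Data), t.src = a ∧ t.tgt = b) a b ↔ a = b := by
      intro a b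
      constructor
      · intro h
        cases h with
        | refl => rfl
        | tail _ h => obtain ⟨_, h, -⟩ := h; cases h
      · rintro rfl; exact .refl
    simp only [closure, List.foldl_nil, List.mem_filter, mem_pairs, decide_eq_true_iff, hnil]
    constructor
    · rintro ⟨⟨a, ha, b, hb, rfl⟩, h⟩
      exact ⟨a, ha, b, hb, h, rfl⟩
    · rintro ⟨a, ha, b, hb, h, rfl⟩
      exact ⟨⟨a, ha, b, hb, rfl⟩, h⟩
  | append_singleton es t ih =>
    have ih := fun z => ih (fun t ht => hes t (by simp [ht])) (z := z)
    have ht := hes t (by simp)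
    have hrel : (fun a b => ∃ t' ∈ es ++ [t], t'.src = a ∧ t'.tgt = b) =
        fun a b => (∃ t' ∈ es, t'.src = a ∧ t'.tgt = b) ∨ (t.src = a ∧ t.tgt = b) := by
      funext a b
      simp [or_and_right, exists_or]
    have hR : ∀ a b, a ∈ qs → b ∈ qs → (cons a b ∈ closure qs es ↔
        Relation.ReflTransGen (fun a b => ∃ t ∈ es, t.src = a ∧ t.tgt = b) a b) := by
      intro a b ha hb
      rw [ih]
      constructor
      · rintro ⟨_, -, _, -, h, h'⟩
        cases h'
        exact h
      · exact fun h => ⟨a, ha, b, hb, h, rfl⟩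
    have hstep : closure qs (es ++ [t]) = closureStep qs t (closure qs es) := by
      simp [closure]
    rw [hstep, hrel, closureStep]
    simp only [List.mem_filter, mem_pairs, Bool.or_eq_true, Bool.and_eq_true, decide_eq_true_iff,
      reflTransGen_or_edge]
    constructor
    · rintro ⟨⟨a, ha, b, hb, rfl⟩, h⟩
      rw [hR _ _ ha hb, hd_cons, tl_cons, hR _ _ ha ht.1, hR _ _ ht.2 hb] at h
      exact ⟨a, ha, b, hb, h, rfl⟩
    · rintro ⟨a, ha, b, hb, h, rfl⟩
      refine ⟨⟨a, ha, b, hb, rfl⟩, ?_⟩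
      rw [hR _ _ ha hb, hd_cons, tl_cons, hR _ _ ha ht.1, hR _ _ ht.2 hb]
      exact h

end Data

open Data Automaton JoinState

/-! ### Names and encodings -/

section Names

variable {Alph Var : Type} {V W : Finset Var} {nA : Alph → Data} {nV : Var → Data}

/-- The encoding of the labels that perform the operation `μ`. -/
def encOp (nV : Var → Data) (μ : Bool × Var) : Data :=
  .cons (.ofNat (if μ.1 then 3 else 2)) (nV μ.2)

theorem encLabel_of_op {o : Label Alph V} {μ : Bool × Var} (h : o.op? = some μ) :
    encLabel nA nV o = encOp nV μ := by
  cases o <;> cases h <;> rfl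

/-- The tags separate the kinds of labels. The larger set `W`, later V₁ ∪ V₂, allows labels of one
automaton to be compared with operations on variables of the other. -/
theorem encLabel_eq_encOp_iff (hV : Set.InjOn nV W) (hVW : V ⊆ W) {o : Label Alph V}
    {μ : Bool × Var} (hμ : μ.2 ∈ W) : encLabel nA nV o = encOp nV μ ↔ o.op? = some μ := by
  refine ⟨fun h => ?_, encLabel_of_op⟩
  obtain ⟨c, v⟩ := μ
  cases o <;> cases c <;>
    simp only [encLabel, encOp, Data.cons.injEq, Data.ofNat_injective.eq_iff] at h <;>
    simp only [Bool.false_eq_true, if_true, if_false] at h <;> try omega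
  · rw [Label.op?, hV (hVW (Subtype.coe_prop _)) hμ h.2]
  · rw [Label.op?, hV (hVW (Subtype.coe_prop _)) hμ h.2]

theorem eq_letter_of_encLabel_eq {V' : Finset Var} (hA : Function.Injective nA) {o : Label Alph V}
    {a : Alph} (h : encLabel nA nV o = encLabel nA nV (Label.letter a : Label Alph V')) :
    o = .letter a := by
  cases o <;> simp only [encLabel, Data.cons.injEq, Data.ofNat_injective.eq_iff] at h <;> try omega
  rw [hA h.2]

theorem encLabel_injective (hA : Function.Injective nA) (hV : Set.InjOn nV V) :
    Function.Injective (encLabel nA nV : Label Alph V → Data) := by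
  intro o o' h
  cases o' with
  | letter a => exact eq_letter_of_encLabel_eq hA h
  | eps =>
    cases o <;> simp only [encLabel, Data.cons.injEq, Data.ofNat_injective.eq_iff] at h <;>
      first | rfl | omega
  | opn v =>
    exact Label.op?_inj ((encLabel_eq_encOp_iff hV subset_rfl (μ := (false, v.1)) v.2).1 h) rfl
  | cls v =>
    exact Label.op?_inj ((encLabel_eq_encOp_iff hV subset_rfl (μ := (true, v.1)) v.2).1 h) rfl

theorem encTrans_injective {Q : Type} {nQ : Q → Data} (hA : Function.Injective nA)
    (hV : Set.InjOn nV V) (hQ : Function.Injective nQ) :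
    Function.Injective (encTrans nA nV nQ : Q × Label Alph V × Q → Data) := by
  rintro ⟨p, o, q⟩ ⟨p', o', q'⟩ h
  simp only [encTrans, Data.cons.injEq] at h
  rw [hQ h.1, encLabel_injective hA hV h.2.1, hQ h.2.2]

theorem readsLetter_encTrans {Q : Type} {nQ : Q → Data} {p q : Q} {o : Label Alph V} :
    (encTrans nA nV nQ (p, o, q)).readsLetter = o.letter?.isSome := by
  cases o <;> simp [readsLetter, lab, encTrans, encLabel, Data.ofNat_injective.eq_iff,
    Label.letter?]

/-- The tree `x` lists the components of `A`. -/
structure Describes (nA : Alph → Data) (nV : Var → Data) (A : Automaton BoolSR Alph V)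
    (nQ : A.Q → Data) (x : Data) : Prop where
  injective : Function.Injective nQ
  mem_vars : ∀ z, z ∈ x.varsOf ↔ ∃ v ∈ V, nV v = z
  mem_states : ∀ z, z ∈ x.statesOf ↔ ∃ q, nQ q = z
  mem_inits : ∀ z, z ∈ x.initsOf ↔ ∃ q, A.init q ≠ 0 ∧ nQ q = z
  mem_fins : ∀ z, z ∈ x.finsOf ↔ ∃ q, A.fin q ≠ 0 ∧ nQ q = z
  mem_trans : ∀ z, z ∈ x.transOf ↔ ∃ p o q, A.δ p o q ≠ 0 ∧ encTrans nA nV nQ (p, o, q) = z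

/-- The list of variables in `Encodes` is coerced to `List Var` by this monadic expression. -/
theorem coe_list_eq_map_val (l : List V) : (do let a ← l; pure (a : Var)) = l.map Subtype.val := by
  induction l with
  | nil => rfl
  | cons a l ih => simp

theorem Encodes.describes {A : Automaton BoolSR Alph V} {x : Data} (h : Encodes nA nV A x) :
    (∃ nQ, Describes nA nV A nQ x) ∧ ∃ lA : List Alph, (∀ a, a ∈ lA) ∧ x.lettersOf = lA.map nA := by
  obtain ⟨nQ, hQ, lA, lV, lQ, lI, lF, lT, hlA, hlV, hlQ, hlI, hlF, hlT, rfl⟩ := h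
  refine ⟨⟨nQ, hQ, ?_, ?_, ?_, ?_, ?_⟩, lA, hlA, ?_⟩ <;>
    simp only [lettersOf, varsOf, statesOf, initsOf, finsOf, transOf, Data.ofList_cons,
      Data.hd_cons, Data.tl_cons, Data.toList_ofList, List.mem_map, coe_list_eq_map_val]
  · exact fun z => ⟨fun ⟨_, ⟨v, _, h⟩, h'⟩ => ⟨v.1, v.2, h ▸ h'⟩,
      fun ⟨v, hv, h⟩ => ⟨v, ⟨⟨v, hv⟩, hlV _, rfl⟩, h⟩⟩
  · exact fun z => ⟨fun ⟨q, _, h⟩ => ⟨q, h⟩, fun ⟨q, h⟩ => ⟨q, hlQ q, h⟩⟩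
  · simp only [hlI, implies_true]
  · simp only [hlF, implies_true]
  · exact fun z => ⟨fun ⟨⟨p, o, q⟩, h, h'⟩ => ⟨p, o, q, (hlT p o q).1 h, h'⟩,
      fun ⟨p, o, q, h, h'⟩ => ⟨⟨p, o, q⟩, (hlT p o q).2 h, h'⟩⟩

namespace Describes

variable {A : Automaton BoolSR Alph V} {nQ : A.Q → Data} {x : Data}

theorem mem_reach (h : Describes nA nV A nQ x) {z : Data} :
    z ∈ x.reach ↔ ∃ p q, A.BlockReach p q ∧ cons (nQ p) (nQ q) = z := by
  have hedge : ∀ a b, (∃ t ∈ x.transOf.filter fun t => !t.readsLetter, t.src = a ∧ t.tgt = b) ↔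
      ∃ p q, (∃ o, o.letter? = none ∧ A.δ p o q ≠ 0) ∧ nQ p = a ∧ nQ q = b := by
    intro a b
    simp only [List.mem_filter, h.mem_trans]
    constructor
    · rintro ⟨_, ⟨⟨p, o, q, hδ, rfl⟩, ho⟩, h1, h2⟩
      rw [readsLetter_encTrans] at ho
      exact ⟨p, q, ⟨o, by simpa using ho, hδ⟩, h1, h2⟩
    · rintro ⟨p, q, ⟨o, ho, hδ⟩, h1, h2⟩
      exact ⟨_, ⟨⟨p, o, q, hδ, rfl⟩, by rw [readsLetter_encTrans]; simp [ho]⟩, h1, h2⟩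
  rw [reach, mem_closure]
  · simp only [hedge, blockReach_iff]
    constructor
    · rintro ⟨a, ha, b, -, hab, rfl⟩
      obtain ⟨p, rfl⟩ := (h.mem_states _).1 ha
      -- A path between names lifts to a path between states because distinct states have distinct
      -- names.
      have key : ∃ q, nQ q = b ∧ Relation.ReflTransGen
          (fun p q => ∃ o, o.letter? = none ∧ A.δ p o q ≠ 0) p q := by
        induction hab with
        | refl => exact ⟨p, rfl, .refl⟩
        | tail _ h1 ih =>
          obtain ⟨q, hq, hpq⟩ := ih
          obtain ⟨q', r, h2, h3, h4⟩ := h1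
          obtain rfl := h.injective (hq.trans h3.symm)
          exact ⟨r, h4, hpq.tail h2⟩
      obtain ⟨q, rfl, hpq⟩ := key
      exact ⟨p, q, hpq, rfl⟩
    · rintro ⟨p, q, hpq, rfl⟩
      refine ⟨_, (h.mem_states _).2 ⟨p, rfl⟩, _, (h.mem_states _).2 ⟨q, rfl⟩, ?_, rfl⟩
      exact hpq.lift nQ fun p q hpq => ⟨p, q, hpq, rfl, rfl⟩
  · intro t ht
    obtain ⟨p, o, q, -, rfl⟩ := (h.mem_trans t).1 (List.mem_of_mem_filter ht)
    exact ⟨(h.mem_states _).2 ⟨p, rfl⟩, (h.mem_states _).2 ⟨q, rfl⟩⟩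

theorem cons_mem_reach (h : Describes nA nV A nQ x) {p q : A.Q} :
    cons (nQ p) (nQ q) ∈ x.reach ↔ A.BlockReach p q := by
  rw [h.mem_reach]
  constructor
  · rintro ⟨p', q', h', e⟩
    rw [Data.cons.injEq] at e
    rwa [← h.injective e.1, ← h.injective e.2]
  · exact fun h' => ⟨p, q, h', rfl⟩

theorem encOp_mem_blockOps (h : Describes nA nV A nQ x) (hV : Set.InjOn nV W) (hVW : V ⊆ W)
    {μ : Bool × Var} (hμ : μ.2 ∈ W) {p q : A.Q} :
    encOp nV μ ∈ blockOps x (nQ p) (nQ q) ↔ A.BlockOp p q μ := by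
  simp only [blockOps, List.mem_map, List.mem_filter, h.mem_trans, Bool.and_eq_true,
    decide_eq_true_iff, blockOp_iff_exists]
  constructor
  · rintro ⟨_, ⟨⟨r, o, r', hδ, rfl⟩, -, h1, h2⟩, ho⟩
    exact ⟨r, o, r', h.cons_mem_reach.1 h1, hδ, (encLabel_eq_encOp_iff hV hVW hμ).1 ho,
      h.cons_mem_reach.1 h2⟩
  · rintro ⟨r, o, r', h1, hδ, ho, h2⟩
    refine ⟨_, ⟨⟨r, o, r', hδ, rfl⟩, ?_, h.cons_mem_reach.2 h1, h.cons_mem_reach.2 h2⟩,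
      encLabel_of_op ho⟩
    rw [readsLetter_encTrans]
    cases o <;> simp [Label.op?, Label.letter?] at ho ⊢

end Describes

/-- The names of the states of the join automaton. -/
def joinName {Q₁ Q₂ : Type} (nA : Alph → Data) (nV : Var → Data) (nQ₁ : Q₁ → Data)
    (nQ₂ : Q₂ → Data) : JoinState Q₁ Q₂ (Label Alph V) → Data
  | base p₁ p₂ => cons nil (cons (nQ₁ p₁) (nQ₂ p₂))
  | chain q₁ q₂ l => cons (cons nil (ofList (l.map (encLabel nA nV)))) (cons (nQ₁ q₁) (nQ₂ q₂))

theorem joinName_injective {Q₁ Q₂ : Type} {nQ₁ : Q₁ → Data} {nQ₂ : Q₂ → Data}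
    (hA : Function.Injective nA) (hV : Set.InjOn nV V) (h₁ : Function.Injective nQ₁)
    (h₂ : Function.Injective nQ₂) : Function.Injective
      (joinName nA nV nQ₁ nQ₂ : JoinState Q₁ Q₂ (Label Alph V) → Data) := by
  rintro (⟨p₁, p₂⟩ | ⟨q₁, q₂, l⟩) (⟨p₁', p₂'⟩ | ⟨q₁', q₂', l'⟩) h <;>
    simp only [joinName, Data.cons.injEq, reduceCtorEq, false_and, true_and] at h
  · rw [h₁ h.1, h₂ h.2]
  · rw [h₁ h.2.1, h₂ h.2.2,
      List.map_injective_iff.2 (encLabel_injective hA hV) (ofList_injective h.1)]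

end Names

/-! ### The output encodes the join automaton -/

section Join

variable {Alph Var : Type} [DecidableEq Var] {V₁ V₂ : Finset Var} {nA : Alph → Data}
  {nV : Var → Data} {A₁ : Automaton BoolSR Alph V₁} {A₂ : Automaton BoolSR Alph V₂}
  {nQ₁ : A₁.Q → Data} {nQ₂ : A₂.Q → Data} {x₁ x₂ : Data} {vs : List ↥(V₁ ∪ V₂)}

/-- The states of the join automaton that the algorithm lists. -/
def Listed (A₁ : Automaton BoolSR Alph V₁) (A₂ : Automaton BoolSR Alph V₂)
    (vs : List ↥(V₁ ∪ V₂)) : JoinState A₁.Q A₂.Q (Label Alph (V₁ ∪ V₂)) → Prop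
  | base _ _ => True
  | chain q₁ q₂ l => l = [] ∨ ∃ p₁ p₂, Jump A₁ A₂ p₁ q₁ p₂ q₂ ∧ l <:+ jumpOps A₁ A₂ vs p₁ q₁ p₂ q₂

/-- Paths cannot leave the listed states, so restricting the infinite type `JoinState` to them loses
no run. -/
theorem Listed.step {s s' o} (hs : Listed A₁ A₂ vs s) (h : JoinStep A₁ A₂ vs s o s') :
    Listed A₁ A₂ vs s' := by
  cases h with
  | jump h => exact .inr ⟨_, _, h, List.suffix_rfl⟩
  | op =>
    obtain h | ⟨p₁, p₂, h, hl⟩ := hs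
    · cases h
    · exact .inr ⟨p₁, p₂, h, (List.suffix_cons _ _).trans hl⟩
  | letter => trivial

/-- The encoding of a jump. -/
def encJump {Q₁ Q₂ : Type} (nQ₁ : Q₁ → Data) (nQ₂ : Q₂ → Data) (p₁ q₁ : Q₁) (p₂ q₂ : Q₂) : Data :=
  cons (cons (nQ₁ p₁) (nQ₁ q₁)) (cons (nQ₂ p₂) (nQ₂ q₂))

theorem joinOps_eq (hvs : joinVars x₁ x₂ = vs.map fun v => nV v.1) :
    joinOps x₁ x₂ = (allOps Alph vs).map (encLabel nA nV) := by
  simp only [joinOps, hvs, allOps, List.map_append, List.map_map]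
  rfl

/-- Equality as lists is needed, as the pending list is part of a state. It holds because both sides
filter the same ordered list of operations. -/
theorem opsOfJump_eq (h₁ : Describes nA nV A₁ nQ₁ x₁) (h₂ : Describes nA nV A₂ nQ₂ x₂)
    (hV : Set.InjOn nV (V₁ ∪ V₂ : Finset Var)) (hvs : joinVars x₁ x₂ = vs.map fun v => nV v.1)
    (p₁ q₁ : A₁.Q) (p₂ q₂ : A₂.Q) : opsOfJump x₁ x₂ (encJump nQ₁ nQ₂ p₁ q₁ p₂ q₂) =
      (jumpOps A₁ A₂ vs p₁ q₁ p₂ q₂).map (encLabel nA nV) := by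
  classical
  rw [opsOfJump, joinOps_eq (nA := nA) hvs, List.filter_map, jumpOps]
  congr 1
  refine List.filter_congr fun o ho => ?_
  obtain ⟨μ, hμ⟩ : ∃ μ, o.op? = some μ := by
    rcases List.mem_append.1 ho with h | h <;> obtain ⟨v, -, rfl⟩ := List.mem_map.1 h <;>
      exact ⟨_, rfl⟩
  have h3 := h₁.encOp_mem_blockOps hV Finset.subset_union_left (Label.mem_of_op? hμ)
    (p := p₁) (q := q₁)
  have h4 := h₂.encOp_mem_blockOps hV Finset.subset_union_right (Label.mem_of_op? hμ)
    (p := p₂) (q := q₂)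
  rw [Bool.eq_iff_iff]
  simp only [encJump, Function.comp_apply, encLabel_of_op hμ, hd_cons, tl_cons, h3, h4,
    Bool.or_eq_true, decide_eq_true_iff, hμ, Option.some.injEq, exists_eq_left']

theorem mem_jumps (h₁ : Describes nA nV A₁ nQ₁ x₁) (h₂ : Describes nA nV A₂ nQ₂ x₂)
    (hV : Set.InjOn nV (V₁ ∪ V₂ : Finset Var)) (hvs : joinVars x₁ x₂ = vs.map fun v => nV v.1)
    (hall : ∀ v, v ∈ vs) {z : Data} : z ∈ jumps x₁ x₂ ↔
      ∃ p₁ q₁ p₂ q₂, Jump A₁ A₂ p₁ q₁ p₂ q₂ ∧ encJump nQ₁ nQ₂ p₁ q₁ p₂ q₂ = z := by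
  have hvars₁ : ∀ v ∈ V₁ ∪ V₂, (nV v ∈ x₁.varsOf ↔ v ∈ V₁) := by
    intro v hv
    rw [h₁.mem_vars]
    exact ⟨fun ⟨v', hv', e⟩ => hV (Finset.mem_union_left _ hv') hv e ▸ hv', fun h => ⟨v, h, rfl⟩⟩
  have hvars₂ : ∀ v ∈ V₁ ∪ V₂, (nV v ∈ x₂.varsOf ↔ v ∈ V₂) := by
    intro v hv
    rw [h₂.mem_vars]
    exact ⟨fun ⟨v', hv', e⟩ => hV (Finset.mem_union_right _ hv') hv e ▸ hv', fun h => ⟨v, h, rfl⟩⟩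
  -- The finite test on names expresses agreement on common variables, as names are injective on V₁
  -- ∪ V₂.
  have hops : ∀ p₁ q₁ p₂ q₂, (∀ o ∈ joinOps x₁ x₂, ¬ (o.tl ∈ x₁.varsOf ∧ o.tl ∈ x₂.varsOf) ∨
      (o ∈ blockOps x₁ (nQ₁ p₁) (nQ₁ q₁) ↔ o ∈ blockOps x₂ (nQ₂ p₂) (nQ₂ q₂))) ↔
      ∀ μ : Bool × Var, μ.2 ∈ V₁ → μ.2 ∈ V₂ → (A₁.BlockOp p₁ q₁ μ ↔ A₂.BlockOp p₂ q₂ μ) := by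
    intro p₁ q₁ p₂ q₂
    have hmem : ∀ o, o ∈ joinOps x₁ x₂ ↔ ∃ μ : Bool × Var, μ.2 ∈ V₁ ∪ V₂ ∧ encOp nV μ = o := by
      intro o
      rw [joinOps_eq (Alph := Alph) (nA := nA) hvs]
      constructor
      · intro ho
        obtain ⟨o, ho', rfl⟩ := List.mem_map.1 ho
        rcases List.mem_append.1 ho' with h | h <;> obtain ⟨v, -, rfl⟩ := List.mem_map.1 h
        · exact ⟨(false, v.1), v.2, rfl⟩
        · exact ⟨(true, v.1), v.2, rfl⟩
      · rintro ⟨⟨c, v⟩, hv, rfl⟩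
        cases c
        · exact List.mem_map.2 ⟨.opn ⟨v, hv⟩, by simp [allOps, hall], rfl⟩
        · exact List.mem_map.2 ⟨.cls ⟨v, hv⟩, by simp [allOps, hall], rfl⟩
    simp only [hmem]
    constructor
    · intro h μ hμ₁ hμ₂
      have hμ := Finset.mem_union_left V₂ hμ₁
      have := (h _ ⟨μ, hμ, rfl⟩).resolve_left fun h => h
        ⟨(hvars₁ _ hμ).2 hμ₁, (hvars₂ _ hμ).2 hμ₂⟩
      rwa [h₁.encOp_mem_blockOps hV Finset.subset_union_left hμ,
        h₂.encOp_mem_blockOps hV Finset.subset_union_right hμ] at this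
    · rintro h _ ⟨μ, hμ, rfl⟩
      rw [h₁.encOp_mem_blockOps hV Finset.subset_union_left hμ,
        h₂.encOp_mem_blockOps hV Finset.subset_union_right hμ]
      have h3 := hvars₁ _ hμ
      have h4 := hvars₂ _ hμ
      have h5 := h μ
      simp only [encOp, tl_cons, h3, h4]
      tauto
  simp only [jumps, List.mem_filter, mem_pairs, h₁.mem_reach, h₂.mem_reach, List.all_eq_true,
    Bool.or_eq_true, Bool.not_eq_true', Bool.and_eq_false_iff, decide_eq_false_iff_not, beq_iff_eq,
    decide_eq_decide, ← not_and_or]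
  constructor
  · rintro ⟨⟨_, ⟨p₁, q₁, hr₁, rfl⟩, _, ⟨p₂, q₂, hr₂, rfl⟩, rfl⟩, h⟩
    exact ⟨p₁, q₁, p₂, q₂, ⟨hr₁, hr₂, (hops _ _ _ _).1 h⟩, rfl⟩
  · rintro ⟨p₁, q₁, p₂, q₂, ⟨hr₁, hr₂, h⟩, rfl⟩
    exact ⟨⟨_, ⟨p₁, q₁, hr₁, rfl⟩, _, ⟨p₂, q₂, hr₂, rfl⟩, rfl⟩, (hops _ _ _ _).2 h⟩

theorem mem_joinStates (h₁ : Describes nA nV A₁ nQ₁ x₁) (h₂ : Describes nA nV A₂ nQ₂ x₂)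
    (hV : Set.InjOn nV (V₁ ∪ V₂ : Finset Var)) (hvs : joinVars x₁ x₂ = vs.map fun v => nV v.1)
    (hall : ∀ v, v ∈ vs) (z : Data) : z ∈ joinStates x₁ x₂ ↔
      ∃ s, Listed A₁ A₂ vs s ∧ joinName nA nV nQ₁ nQ₂ s = z := by
  simp only [joinStates, List.mem_append, List.mem_map, List.mem_flatMap, mem_pairs,
    h₁.mem_states, h₂.mem_states, mem_jumps h₁ h₂ hV hvs hall]
  constructor
  · rintro (⟨_, ⟨_, ⟨p₁, rfl⟩, _, ⟨p₂, rfl⟩, rfl⟩, rfl⟩ |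
      ⟨_, ⟨_, ⟨p₁, rfl⟩, _, ⟨p₂, rfl⟩, rfl⟩, rfl⟩ | ⟨_, ⟨p₁, q₁, p₂, q₂, hj, rfl⟩, l, hl, rfl⟩)
    · exact ⟨base p₁ p₂, trivial, rfl⟩
    · exact ⟨chain p₁ p₂ [], .inl rfl, rfl⟩
    · obtain ⟨m, hm, rfl⟩ := mem_suffixes.1 hl
      rw [opsOfJump_eq h₁ h₂ hV hvs] at hm
      obtain ⟨l, hl', rfl⟩ := List.suffix_map_iff.1 hm
      exact ⟨chain q₁ q₂ l, .inr ⟨p₁, p₂, hj, hl'⟩, rfl⟩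
  · rintro ⟨⟨p₁, p₂⟩ | ⟨q₁, q₂, l⟩, h, rfl⟩
    · exact .inl ⟨_, ⟨_, ⟨p₁, rfl⟩, _, ⟨p₂, rfl⟩, rfl⟩, rfl⟩
    · rcases h with rfl | ⟨p₁, p₂, hj, hl⟩
      -- All pairs with an empty list are included, whether or not a jump ends there; accepting
      -- states and sources of letter transitions are thus always listed.
      · exact .inr (.inl ⟨_, ⟨_, ⟨q₁, rfl⟩, _, ⟨q₂, rfl⟩, rfl⟩, rfl⟩)
      · refine .inr (.inr ⟨_, ⟨p₁, q₁, p₂, q₂, hj, rfl⟩, _, mem_suffixes.2 ⟨_, ?_, rfl⟩, rfl⟩)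
        rw [opsOfJump_eq h₁ h₂ hV hvs]
        exact List.suffix_map_iff.2 ⟨l, hl, rfl⟩

theorem mem_joinInits (h₁ : Describes nA nV A₁ nQ₁ x₁) (h₂ : Describes nA nV A₂ nQ₂ x₂) (z : Data) :
    z ∈ joinInits x₁ x₂ ↔ ∃ s, JoinInit A₁ A₂ s ∧ joinName nA nV nQ₁ nQ₂ s = z := by
  simp only [joinInits, List.mem_map, mem_pairs, h₁.mem_inits, h₂.mem_inits]
  constructor
  · rintro ⟨_, ⟨_, ⟨p₁, hp₁, rfl⟩, _, ⟨p₂, hp₂, rfl⟩, rfl⟩, rfl⟩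
    exact ⟨base p₁ p₂, ⟨_, _, rfl, hp₁, hp₂⟩, rfl⟩
  · rintro ⟨_, ⟨p₁, p₂, rfl, hp₁, hp₂⟩, rfl⟩
    exact ⟨_, ⟨_, ⟨p₁, hp₁, rfl⟩, _, ⟨p₂, hp₂, rfl⟩, rfl⟩, rfl⟩

theorem mem_joinFins (h₁ : Describes nA nV A₁ nQ₁ x₁) (h₂ : Describes nA nV A₂ nQ₂ x₂) (z : Data) :
    z ∈ joinFins x₁ x₂ ↔ ∃ s, JoinFin A₁ A₂ s ∧ joinName nA nV nQ₁ nQ₂ s = z := by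
  simp only [joinFins, List.mem_map, mem_pairs, h₁.mem_fins, h₂.mem_fins]
  constructor
  · rintro ⟨_, ⟨_, ⟨p₁, hp₁, rfl⟩, _, ⟨p₂, hp₂, rfl⟩, rfl⟩, rfl⟩
    exact ⟨chain p₁ p₂ [], ⟨_, _, rfl, hp₁, hp₂⟩, rfl⟩
  · rintro ⟨_, ⟨p₁, p₂, rfl, hp₁, hp₂⟩, rfl⟩
    exact ⟨_, ⟨_, ⟨p₁, hp₁, rfl⟩, _, ⟨p₂, hp₂, rfl⟩, rfl⟩, rfl⟩

theorem mem_joinTrans (h₁ : Describes nA nV A₁ nQ₁ x₁) (h₂ : Describes nA nV A₂ nQ₂ x₂)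
    (hA : Function.Injective nA) (hV : Set.InjOn nV (V₁ ∪ V₂ : Finset Var))
    (hvs : joinVars x₁ x₂ = vs.map fun v => nV v.1) (hall : ∀ v, v ∈ vs) (z : Data) :
    z ∈ jumpTrans x₁ x₂ ++ (opTrans x₁ x₂ ++ letterTrans x₁ x₂) ↔
      ∃ s o s', (Listed A₁ A₂ vs s ∧ JoinStep A₁ A₂ vs s o s') ∧
        encTrans nA nV (joinName nA nV nQ₁ nQ₂) (s, o, s') = z := by
  simp only [jumpTrans, opTrans, letterTrans, List.mem_append, List.mem_map, List.mem_flatMap,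
    List.mem_filter, mem_pairs, mem_jumps h₁ h₂ hV hvs hall, h₁.mem_trans, h₂.mem_trans,
    Bool.and_eq_true, decide_eq_true_iff]
  constructor
  · rintro (⟨_, ⟨p₁, q₁, p₂, q₂, hj, rfl⟩, rfl⟩ |
      ⟨_, ⟨p₁, q₁, p₂, q₂, hj, rfl⟩, l, ⟨hl, hne⟩, rfl⟩ |
      ⟨_, ⟨⟨_, ⟨q₁, o₁, r₁, hδ₁, rfl⟩, _, ⟨q₂, o₂, r₂, hδ₂, rfl⟩, rfl⟩, hlet, heq⟩, rfl⟩)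
    · refine ⟨base p₁ p₂, .eps, _, ⟨trivial, .jump hj⟩, ?_⟩
      rw [opsOfJump_eq h₁ h₂ hV hvs]
      rfl
    · obtain ⟨m, hm, rfl⟩ := mem_suffixes.1 hl
      rw [opsOfJump_eq h₁ h₂ hV hvs] at hm
      obtain ⟨l, hl', rfl⟩ := List.suffix_map_iff.1 hm
      cases l with
      | nil => simp at hne
      | cons o l => exact ⟨chain q₁ q₂ (o :: l), o, _, ⟨.inr ⟨p₁, p₂, hj, hl'⟩, .op⟩, rfl⟩
    · rw [hd_cons, readsLetter_encTrans] at hlet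
      cases o₁ with
      | letter a =>
        obtain rfl := eq_letter_of_encLabel_eq (V' := V₁) (nV := nV) (a := a) hA (Eq.symm heq)
        exact ⟨chain q₁ q₂ [], .letter a, _, ⟨.inl rfl, .letter hδ₁ hδ₂⟩, rfl⟩
      | _ => simp [Label.letter?] at hlet
  · rintro ⟨s, o, s', ⟨hs, h⟩, rfl⟩
    cases h with
    | @jump p₁ q₁ p₂ q₂ hj =>
      refine .inl ⟨_, ⟨p₁, q₁, p₂, q₂, hj, rfl⟩, ?_⟩
      rw [opsOfJump_eq h₁ h₂ hV hvs]
      rfl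
    | @op q₁ q₂ o l =>
      obtain h | ⟨p₁, p₂, hj, hl⟩ := hs
      · cases h
      · refine .inr (.inl ⟨_, ⟨p₁, q₁, p₂, q₂, hj, rfl⟩, _, ⟨mem_suffixes.2
          ⟨(o :: l).map (encLabel nA nV), ?_, rfl⟩, by simp⟩, rfl⟩)
        rw [opsOfJump_eq h₁ h₂ hV hvs]
        exact List.suffix_map_iff.2 ⟨_, hl, rfl⟩
    | @letter q₁ q₂ a r₁ r₂ hδ₁ hδ₂ =>
      refine .inr (.inr ⟨_, ⟨⟨_, ⟨q₁, _, r₁, hδ₁, rfl⟩, _, ⟨q₂, _, r₂, hδ₂, rfl⟩, rfl⟩, ?_, rfl⟩,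
        rfl⟩)
      rw [hd_cons, readsLetter_encTrans]
      rfl

/-- Each of the computed lists of variables, states and transitions is pulled back along its
injective naming. Repeated variables in the output are harmless, and the letters can be taken from
`x₁` since the alphabet is shared. -/
theorem encodes_joinAutomaton (h₁ : Describes nA nV A₁ nQ₁ x₁) (h₂ : Describes nA nV A₂ nQ₂ x₂)
    (hA : Function.Injective nA) (hV : Set.InjOn nV (V₁ ∪ V₂ : Finset Var))
    (hvs : joinVars x₁ x₂ = vs.map fun v => nV v.1) (hall : ∀ v, v ∈ vs) {lA : List Alph}
    (hlA : ∀ a, a ∈ lA) (hx₁ : x₁.lettersOf = lA.map nA)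
    {ss : List (JoinState A₁.Q A₂.Q (Label Alph (V₁ ∪ V₂)))}
    (hss : ∀ s, s ∈ ss ↔ Listed A₁ A₂ vs s) :
    Encodes nA nV (joinAutomaton A₁ A₂ vs ss) (joinData x₁ x₂) := by
  have hinj : Function.Injective (joinName nA nV nQ₁ nQ₂ ∘ joinVal A₁ A₂ vs ss) :=
    (joinName_injective hA hV h₁.injective h₂.injective).comp joinVal_injective
  have hlisted : ∀ s, Listed A₁ A₂ vs (joinVal A₁ A₂ vs ss s) := fun s => (hss _).1 s.2
  have hlift : ∀ s, Listed A₁ A₂ vs s → ∃ s', joinVal A₁ A₂ vs ss s' = s :=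
    fun s hs => ⟨⟨s, (hss s).2 hs⟩, rfl⟩
  obtain ⟨lV, hlV, hlV'⟩ := exists_list_of_mem_iff (l := x₁.varsOf ++ x₂.varsOf)
    (f := fun v : ↥(V₁ ∪ V₂) => nV v) (P := fun _ => True)
    (fun v v' h => Subtype.ext (hV v.2 v'.2 h)) (by
      intro z
      rw [List.mem_append, h₁.mem_vars, h₂.mem_vars]
      simp [or_and_right, exists_or])
  obtain ⟨lQ, hlQ, hlQ'⟩ := exists_list_of_mem_iff (l := joinStates x₁ x₂)
    (P := fun _ => True) hinj (by
    intro z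
    rw [mem_joinStates h₁ h₂ hV hvs hall]
    constructor
    · rintro ⟨s, hs, rfl⟩
      obtain ⟨s, rfl⟩ := hlift s hs
      exact ⟨s, trivial, rfl⟩
    · rintro ⟨s, -, rfl⟩
      exact ⟨_, hlisted s, rfl⟩)
  obtain ⟨lI, hlI, hlI'⟩ := exists_list_of_mem_iff (l := joinInits x₁ x₂)
    (P := fun s => (joinAutomaton A₁ A₂ vs ss).init s ≠ 0) hinj (by
    intro z
    simp only [mem_joinInits h₁ h₂, joinAutomaton_init]
    constructor
    · rintro ⟨s, hs, rfl⟩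
      obtain ⟨s, rfl⟩ := hlift s (by obtain ⟨_, _, rfl, -⟩ := hs; trivial)
      exact ⟨s, hs, rfl⟩
    · rintro ⟨s, hs, rfl⟩
      exact ⟨_, hs, rfl⟩)
  obtain ⟨lF, hlF, hlF'⟩ := exists_list_of_mem_iff (l := joinFins x₁ x₂)
    (P := fun s => (joinAutomaton A₁ A₂ vs ss).fin s ≠ 0) hinj (by
    intro z
    simp only [mem_joinFins h₁ h₂, joinAutomaton_fin]
    constructor
    · rintro ⟨s, hs, rfl⟩
      obtain ⟨s, rfl⟩ := hlift s (by obtain ⟨_, _, rfl, -⟩ := hs; exact .inl rfl)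
      exact ⟨s, hs, rfl⟩
    · rintro ⟨s, hs, rfl⟩
      exact ⟨_, hs, rfl⟩)
  obtain ⟨lT, hlT, hlT'⟩ := exists_list_of_mem_iff
    (l := jumpTrans x₁ x₂ ++ (opTrans x₁ x₂ ++ letterTrans x₁ x₂))
    (P := fun e => (joinAutomaton A₁ A₂ vs ss).δ e.1 e.2.1 e.2.2 ≠ 0)
    (encTrans_injective hA hV hinj) (by
    intro z
    simp only [mem_joinTrans h₁ h₂ hA hV hvs hall, joinAutomaton_δ]
    constructor
    · rintro ⟨s, o, s', ⟨hs, h⟩, rfl⟩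
      obtain ⟨s', rfl⟩ := hlift s' (hs.step h)
      obtain ⟨s, rfl⟩ := hlift s hs
      exact ⟨(s, o, s'), h, rfl⟩
    · rintro ⟨⟨s, o, s'⟩, h, rfl⟩
      exact ⟨_, o, _, ⟨hlisted s, h⟩, rfl⟩)
  refine ⟨_, hinj, lA, lV, lQ, lI, lF, lT, hlA, fun v => (hlV' v).2 trivial,
    fun q => (hlQ' q).2 trivial, hlI', hlF', fun p o q => hlT' (p, o, q), ?_⟩
  rw [joinData, hx₁, hlV, hlQ, hlI, hlF, hlT, coe_list_eq_map_val, List.map_map]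
  rfl

end Join

end VSet

theorem mainTheorem12 :
    ∃ (p : VSet.Prog) (P : Polynomial ℕ),
      ∀ {Alph Var : Type} [Finite Alph] [DecidableEq Var]
        (nA : Alph → VSet.Data) (nV : Var → VSet.Data) {V₁ V₂ : Finset Var}
        (A₁ : VSet.Automaton VSet.BoolSR Alph V₁) (A₂ : VSet.Automaton VSet.BoolSR Alph V₂)
        (x₁ x₂ : VSet.Data),
        Function.Injective nA → Set.InjOn nV (↑(V₁ ∪ V₂) : Set Var) →
        A₁.Functional → A₁.Unambiguous → A₂.Functional → A₂.Unambiguous →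
        VSet.Encodes nA nV A₁ x₁ → VSet.Encodes nA nV A₂ x₂ →
        ∃ (y : VSet.Data) (t : ℕ) (A : VSet.Automaton VSet.BoolSR Alph (V₁ ∪ V₂)),
          p.Runs (.cons x₁ x₂) y t ∧ t ≤ P.eval (VSet.Data.cons x₁ x₂).size ∧
          VSet.Encodes nA nV A y ∧ A.Functional ∧ A.Unambiguous ∧
          A.annotator = VSet.Annotator.join A₁.annotator A₂.annotator := by
  obtain ⟨p, P, hp⟩ := VSet.polyTime_joinData
  refine ⟨p, P, ?_⟩
  intro Alph Var _ _ nA nV V₁ V₂ A₁ A₂ x₁ x₂ hA hV hf₁ hu₁ hf₂ hu₂ he₁ he₂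
  obtain ⟨⟨nQ₁, h₁⟩, lA, hlA, hx₁⟩ := he₁.describes
  obtain ⟨⟨nQ₂, h₂⟩, -⟩ := he₂.describes
  obtain ⟨hnd, hmem⟩ := VSet.Data.dedup_spec (x₁.varsOf ++ x₂.varsOf)
  -- The order of the variables in the abstract construction is the one computed by the program. It
  -- has no repetitions, so a jump performs no operation twice.
  obtain ⟨vs, hvs, hall⟩ := VSet.exists_list_of_mem_iff (l := VSet.Data.joinVars x₁ x₂)
    (f := fun v : ↥(V₁ ∪ V₂) => nV v) (P := fun _ => True)
    (fun v v' h => Subtype.ext (hV v.2 v'.2 h)) (by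
      intro z
      rw [VSet.Data.joinVars, hmem, List.mem_append, h₁.mem_vars, h₂.mem_vars]
      simp [or_and_right, exists_or])
  have hall : ∀ v, v ∈ vs := fun v => (hall v).2 trivial
  have hnd : vs.Nodup := by
    rw [← VSet.Data.joinVars, hvs] at hnd
    exact hnd.of_map
  -- The computed list of state names serves to show that only finitely many states are listed.
  obtain ⟨ss, -, hss⟩ := VSet.exists_list_of_mem_iff
    (VSet.joinName_injective hA hV h₁.injective h₂.injective)
    (VSet.mem_joinStates h₁ h₂ hV hvs hall)
  obtain ⟨t, hrun, ht⟩ := hp (.cons x₁ x₂)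
  refine ⟨_, t, VSet.joinAutomaton A₁ A₂ vs ss, hrun, ht,
    VSet.encodes_joinAutomaton h₁ h₂ hA hV hvs hall hlA hx₁ hss,
    VSet.joinAutomaton_functional hnd hall hf₁ hf₂,
    VSet.joinAutomaton_unambiguous hnd hall hf₁ hf₂ hu₁ hu₂,
    VSet.joinAutomaton_annotator (fun s o s' hs h => (hss s').2 (((hss s).1 hs).step h))
      (fun p₁ p₂ => (hss _).2 trivial) hnd hall hf₁ hf₂⟩
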